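/- Let $n,m\ge 1$. Let $\mathbb H_n$ be the space of complex symmetric $n\times n$ matrices with positive definite imaginary part, and write the points of $\mathbb H_{n,m}=\mathbb H_n\times\mathbb C^{(m,n)}$ as $(Z,W)$, with $W$ of size $m\times n$, $Y=\operatorname{Im}Z$, $V=\operatorname{Im}W$. Let $G^J=\mathrm{Sp}(n,\mathbb R)\ltimes H_{\mathbb R}^{(n,m)}$ be the Jacobi group: its elements are $g=\left(\begin{pmatrix}A&B\\C&D\end{pmatrix},(\lambda,\mu;\kappa)\right)$ with $\lambda,\mu\in\mathbb R^{(m,n)}$, $\kappa\in\mathbb R^{(m,m)}$, $\kappa+\mu\lambda^t$ symmetric, with product $$(S,(\lambda,\mu;\kappa))(S',(\lambda',\mu';\kappa'))=(SS',(\tilde\lambda+\lambda',\tilde\mu+\mu';\kappa+\kappa'+\tilde\lambda\mu'^t-\tilde\mu\lambda'^t)),\qquad(\tilde\lambda,\tilde\mu)=(\lambda,\mu)S'.$$ It acts on $\mathbb H_{n,m}$ by $g(Z,W)=((AZ+B)(CZ+D)^{-1},(W+\lambda Z+\mu)(CZ+D)^{-1})$. Let $\Gamma$ be a subgroup of $G^J$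 (for instance the integral Jacobi group). For $k\in\mathbb Z$ and a positive definite half-integral $m\times m$ matrix $M$ (that is, $M_{ii}\in\mathbb Z$ and $2M_{ij}\in\mathbb Z$), a Jacobi form of weight $k$ and index $M$ for $\Gamma$ is a $C^\infty$ function $f:\mathbb H_{n,m}\to\mathbb C$ (not necessarily holomorphic) such that for all $g\in\Gamma$ $$f(g(Z,W))=\det(CZ+D)^k\,e^{2\pi i\operatorname{Tr}\left(M(W+\lambda Z+\mu)(CZ+D)^{-1}C(W+\lambda Z+\mu)^t-M(\lambda Z\lambda^t+2\lambda W^t+\kappa+\mu\lambda^t)\right)}f(Z,W).$$ Let $J_{k,M}$ be the set of these. Let $\frac{\partial f}{\partial W}$ be the $n\times m$ matrix with $(j,i)$ entry $\frac{\partial f}{\partial w_{ij}}$, let $\frac{\partial f}{\partial Z}$ be the symmetric matrix with $(i,j)$ entry $\frac{1+\delta_{ij}}2\frac{\partial f}{\partial z_{ij}}$, define $\frac{\partial f}{\partial\overline W},\frac{\partial f}{\partial\overline Z}$ in the same way, and let $\frac{\partial}{\partial W}M^{-1}\left(\frac{\partial f}{\partial W}\right)^t$ be the $n\times n$ matrix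 with $(a,b)$ entry $\sum_{i,j}(M^{-1})_{ij}\frac{\partial^2f}{\partial w_{ia}\partial w_{jb}}$. Theorem. Let $f\in J_{k,M}$. (a) Suppose $n\le m$. For every choice of $n$ distinct rows of $W$, with $[\,\cdot\,]$ denoting the $n\times n$ matrix of the corresponding columns of an $n\times m$ matrix (the whole matrix if $n=m$), $$D_1(f)=\det\left[\frac{\partial f}{\partial W}+4\pi i\,Y^{-1}V^tM f\right]\in J_{nk+1,nM},\qquad \delta_1(f)=\det\left(\left[\frac{\partial f}{\partial\overline W}\right]Y\right)\in J_{nk-1,nM}.$$ (b) For all $n,m\ge1$, $$L_{k,M}(f)=\det\left(-8\pi i\frac{\partial f}{\partial Z}+\frac{\partial}{\partial W}M^{-1}\left(\frac{\partial f}{\partial W}\right)^t-4\pi kfY^{-1}+2m\pi fY^{-1}\right)\in J_{nk+2,nM},$$ $$D_2(f)=\det\left(\frac{\partial f}{\partial Z}-\frac{ik}2fY^{-1}+2\pi i\,Y^{-1}V^tMVY^{-1}f+\frac12\frac{\partial f}{\partial W}VY^{-1}+\frac12Y^{-1}V^t\left(\frac{\partial f}{\partial W}\right)^t\right)\in J_{nk+2,nM},$$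 $$\delta_2(f)=\det\left(Y\frac{\partial f}{\partial\overline Z}Y+\frac12Y\frac{\partial f}{\partial\overline W}V+\frac12V^t\left(\frac{\partial f}{\partial\overline W}\right)^tY\right)\in J_{nk-2,nM}.$$ -/

import Mathlib

open scoped ContDiff Matrix

noncomputable section

namespace SiegelJacobi

/-! ### The Jacobi group -/

section Group

variable {n m : ℕ}

/-- The left half `lam * A + mu * C` of the row `(lam, mu) * S`, where `S = (A, B; C, D)`. -/
def rowLeft (S : Matrix (Fin n ⊕ Fin n) (Fin n ⊕ Fin n) ℝ) (lam mu : Matrix (Fin m) (Fin n) ℝ) :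
    Matrix (Fin m) (Fin n) ℝ :=
  lam * S.toBlocks₁₁ + mu * S.toBlocks₂₁

/-- The right half `lam * B + mu * D` of the row `(lam, mu) * S`, where `S = (A, B; C, D)`. -/
def rowRight (S : Matrix (Fin n ⊕ Fin n) (Fin n ⊕ Fin n) ℝ) (lam mu : Matrix (Fin m) (Fin n) ℝ) :
    Matrix (Fin m) (Fin n) ℝ :=
  lam * S.toBlocks₁₂ + mu * S.toBlocks₂₂

/-- The Jacobi group `Sp(n, ℝ) ⋉ H_ℝ^{(n,m)}`: its elements are pairs `(S, (lam, mu; kappa))` with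
`S` symplectic and `kappa + mu * lamᵀ` symmetric. -/
@[ext]
structure JacobiGroup (n m : ℕ) where
  sp : Matrix.symplecticGroup (Fin n) ℝ
  lam : Matrix (Fin m) (Fin n) ℝ
  mu : Matrix (Fin m) (Fin n) ℝ
  kappa : Matrix (Fin m) (Fin m) ℝ
  symm : (kappa + mu * lamᵀ).IsSymm

theorem rowLeft_mul (S S' : Matrix (Fin n ⊕ Fin n) (Fin n ⊕ Fin n) ℝ)
    (lam mu : Matrix (Fin m) (Fin n) ℝ) :
    rowLeft (S * S') lam mu = rowLeft S' (rowLeft S lam mu) (rowRight S lam mu) := by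
  conv_lhs => rw [← Matrix.fromBlocks_toBlocks S, ← Matrix.fromBlocks_toBlocks S',
    Matrix.fromBlocks_multiply]
  simp only [rowLeft, rowRight, Matrix.toBlocks_fromBlocks₁₁, Matrix.toBlocks_fromBlocks₂₁,
    Matrix.mul_add, Matrix.add_mul, Matrix.mul_assoc]
  abel

theorem rowRight_mul (S S' : Matrix (Fin n ⊕ Fin n) (Fin n ⊕ Fin n) ℝ)
    (lam mu : Matrix (Fin m) (Fin n) ℝ) :
    rowRight (S * S') lam mu = rowRight S' (rowLeft S lam mu) (rowRight S lam mu) := by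
  conv_lhs => rw [← Matrix.fromBlocks_toBlocks S, ← Matrix.fromBlocks_toBlocks S',
    Matrix.fromBlocks_multiply]
  simp only [rowLeft, rowRight, Matrix.toBlocks_fromBlocks₁₂, Matrix.toBlocks_fromBlocks₂₂,
    Matrix.mul_add, Matrix.add_mul, Matrix.mul_assoc]
  abel

theorem rowLeft_one (lam mu : Matrix (Fin m) (Fin n) ℝ) : rowLeft 1 lam mu = lam := by
  rw [rowLeft, ← Matrix.fromBlocks_one, Matrix.toBlocks_fromBlocks₁₁, Matrix.toBlocks_fromBlocks₂₁,
    Matrix.mul_one, Matrix.mul_zero, add_zero]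

theorem rowRight_one (lam mu : Matrix (Fin m) (Fin n) ℝ) : rowRight 1 lam mu = mu := by
  rw [rowRight, ← Matrix.fromBlocks_one, Matrix.toBlocks_fromBlocks₁₂,
    Matrix.toBlocks_fromBlocks₂₂, Matrix.mul_one, Matrix.mul_zero, zero_add]

theorem rowLeft_add (S : Matrix (Fin n ⊕ Fin n) (Fin n ⊕ Fin n) ℝ)
    (a b c d : Matrix (Fin m) (Fin n) ℝ) :
    rowLeft S (a + b) (c + d) = rowLeft S a c + rowLeft S b d := by
  simp only [rowLeft, Matrix.add_mul]
  abel

theorem rowRight_add (S : Matrix (Fin n ⊕ Fin n) (Fin n ⊕ Fin n) ℝ)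
    (a b c d : Matrix (Fin m) (Fin n) ℝ) :
    rowRight S (a + b) (c + d) = rowRight S a c + rowRight S b d := by
  simp only [rowRight, Matrix.add_mul]
  abel

theorem rowLeft_neg (S : Matrix (Fin n ⊕ Fin n) (Fin n ⊕ Fin n) ℝ)
    (a c : Matrix (Fin m) (Fin n) ℝ) : rowLeft S (-a) (-c) = -rowLeft S a c := by
  simp only [rowLeft, Matrix.neg_mul]
  abel

theorem rowRight_neg (S : Matrix (Fin n ⊕ Fin n) (Fin n ⊕ Fin n) ℝ)
    (a c : Matrix (Fin m) (Fin n) ℝ) : rowRight S (-a) (-c) = -rowRight S a c := by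
  simp only [rowRight, Matrix.neg_mul]
  abel

theorem block_relations {S : Matrix (Fin n ⊕ Fin n) (Fin n ⊕ Fin n) ℝ}
    (hS : S ∈ Matrix.symplecticGroup (Fin n) ℝ) :
    S.toBlocks₁₁ * S.toBlocks₁₂ᵀ = S.toBlocks₁₂ * S.toBlocks₁₁ᵀ ∧
    S.toBlocks₂₁ * S.toBlocks₂₂ᵀ = S.toBlocks₂₂ * S.toBlocks₂₁ᵀ ∧
    S.toBlocks₁₁ * S.toBlocks₂₂ᵀ = 1 + S.toBlocks₁₂ * S.toBlocks₂₁ᵀ ∧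
    S.toBlocks₂₂ * S.toBlocks₁₁ᵀ = 1 + S.toBlocks₂₁ * S.toBlocks₁₂ᵀ := by
  rw [SymplecticGroup.mem_iff, ← Matrix.fromBlocks_toBlocks S, Matrix.J,
    Matrix.fromBlocks_multiply, Matrix.fromBlocks_transpose, Matrix.fromBlocks_multiply,
    Matrix.fromBlocks_inj] at hS
  obtain ⟨h1, h2, h3, h4⟩ := hS
  simp only [Matrix.mul_zero, Matrix.mul_one, Matrix.mul_neg, zero_add, add_zero,
    Matrix.neg_mul] at h1 h2 h3 h4
  refine ⟨?_, ?_, ?_, ?_⟩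
  · rw [← sub_eq_zero, ← neg_eq_zero, ← h1]; abel
  · rw [← sub_eq_zero, ← neg_eq_zero, ← h4]; abel
  · rw [← neg_inj, ← sub_eq_zero, ← sub_eq_zero.mpr h2]; abel
  · rw [← sub_eq_zero, ← sub_eq_zero.mpr h3]; abel

theorem row_pairing {S : Matrix (Fin n ⊕ Fin n) (Fin n ⊕ Fin n) ℝ}
    (hS : S ∈ Matrix.symplecticGroup (Fin n) ℝ) (a b c d : Matrix (Fin m) (Fin n) ℝ) :
    rowLeft S a b * (rowRight S c d)ᵀ - rowRight S a b * (rowLeft S c d)ᵀ =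
      a * dᵀ - b * cᵀ := by
  obtain ⟨h1, h2, h3, h4⟩ := block_relations hS
  have e : rowLeft S a b * (rowRight S c d)ᵀ - rowRight S a b * (rowLeft S c d)ᵀ =
      a * (S.toBlocks₁₁ * S.toBlocks₁₂ᵀ - S.toBlocks₁₂ * S.toBlocks₁₁ᵀ) * cᵀ +
      a * (S.toBlocks₁₁ * S.toBlocks₂₂ᵀ - S.toBlocks₁₂ * S.toBlocks₂₁ᵀ) * dᵀ +
      b * (S.toBlocks₂₁ * S.toBlocks₁₂ᵀ - S.toBlocks₂₂ * S.toBlocks₁₁ᵀ) * cᵀ +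
      b * (S.toBlocks₂₁ * S.toBlocks₂₂ᵀ - S.toBlocks₂₂ * S.toBlocks₂₁ᵀ) * dᵀ := by
    simp only [rowLeft, rowRight, Matrix.transpose_add, Matrix.transpose_mul, Matrix.mul_add,
      Matrix.add_mul, Matrix.mul_sub, Matrix.sub_mul, Matrix.mul_assoc]
    abel
  rw [e, h1, h2, h3, h4]
  simp only [sub_self, add_sub_cancel_right, Matrix.mul_zero, Matrix.zero_mul, Matrix.mul_one,
    sub_add_cancel_right, Matrix.mul_neg, Matrix.neg_mul, zero_add, add_zero]
  abel

theorem symm_twist {S : Matrix (Fin n ⊕ Fin n) (Fin n ⊕ Fin n) ℝ}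
    (hS : S ∈ Matrix.symplecticGroup (Fin n) ℝ) {a b : Matrix (Fin m) (Fin n) ℝ}
    {x : Matrix (Fin m) (Fin m) ℝ} (hx : (x + b * aᵀ).IsSymm) :
    (x + rowRight S a b * (rowLeft S a b)ᵀ).IsSymm := by
  have h := row_pairing hS a b a b
  rw [Matrix.IsSymm] at hx ⊢
  simp only [Matrix.transpose_add, Matrix.transpose_mul, Matrix.transpose_transpose] at hx ⊢
  have h' : rowLeft S a b * (rowRight S a b)ᵀ =
      a * bᵀ - b * aᵀ + rowRight S a b * (rowLeft S a b)ᵀ := by rw [← h]; abel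
  have h'' : xᵀ + a * bᵀ - b * aᵀ = x := by rw [hx]; abel
  rw [h']
  nth_rewrite 2 [← h'']
  abel

/-- The product
`(S, (lam, mu; kappa)) (S', (lam', mu'; kappa')) = (S S', (l + lam', u + mu'; kappa + kappa' + l mu'ᵀ - u lam'ᵀ))`
where `(l, u) = (lam, mu) S'`. -/
instance : Mul (JacobiGroup n m) where
  mul g h :=
    { sp := g.sp * h.sp
      lam := rowLeft h.sp g.lam g.mu + h.lam
      mu := rowRight h.sp g.lam g.mu + h.mu
      kappa := g.kappa + h.kappa + rowLeft h.sp g.lam g.mu * h.muᵀ -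
        rowRight h.sp g.lam g.mu * h.lamᵀ
      symm := by
        have h1 := symm_twist h.sp.2 g.symm
        have h2 := h.symm
        rw [Matrix.IsSymm] at h1 h2 ⊢
        simp only [Matrix.transpose_add, Matrix.transpose_mul, Matrix.transpose_transpose,
          Matrix.transpose_sub, Matrix.mul_add, Matrix.add_mul] at h1 h2 ⊢
        rw [← sub_eq_zero] at h1 h2 ⊢
        rw [← add_zero (0 : Matrix (Fin m) (Fin m) ℝ)]
        nth_rewrite 1 [← h1]
        rw [← h2]
        abel }

instance : One (JacobiGroup n m) where
  one := { sp := 1, lam := 0, mu := 0, kappa := 0, symm := by simp [Matrix.IsSymm] }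

instance : Inv (JacobiGroup n m) where
  inv g :=
    { sp := g.sp⁻¹
      lam := -rowLeft (g.sp⁻¹ : Matrix.symplecticGroup (Fin n) ℝ) g.lam g.mu
      mu := -rowRight (g.sp⁻¹ : Matrix.symplecticGroup (Fin n) ℝ) g.lam g.mu
      kappa := -g.kappaᵀ
      symm := by
        have h0 : (-g.kappaᵀ + g.mu * g.lamᵀ).IsSymm := by
          have h := g.symm
          rw [Matrix.IsSymm] at h ⊢
          simp only [Matrix.transpose_add, Matrix.transpose_mul, Matrix.transpose_transpose,
            Matrix.transpose_neg] at h ⊢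
          rw [← sub_eq_zero] at h ⊢
          rw [← h]
          abel
        have h1 := symm_twist (g.sp⁻¹).2 h0
        rwa [Matrix.transpose_neg, Matrix.neg_mul, Matrix.mul_neg, neg_neg] }

theorem JacobiGroup.mul_def (g h : JacobiGroup n m) :
    (g * h).sp = g.sp * h.sp ∧ (g * h).lam = rowLeft h.sp g.lam g.mu + h.lam ∧
    (g * h).mu = rowRight h.sp g.lam g.mu + h.mu ∧
    (g * h).kappa = g.kappa + h.kappa + rowLeft h.sp g.lam g.mu * h.muᵀ -
        rowRight h.sp g.lam g.mu * h.lamᵀ := ⟨rfl, rfl, rfl, rfl⟩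

theorem JacobiGroup.one_def :
    (1 : JacobiGroup n m).sp = 1 ∧ (1 : JacobiGroup n m).lam = 0 ∧
    (1 : JacobiGroup n m).mu = 0 ∧ (1 : JacobiGroup n m).kappa = 0 := ⟨rfl, rfl, rfl, rfl⟩

theorem JacobiGroup.inv_def (g : JacobiGroup n m) :
    g⁻¹.sp = g.sp⁻¹ ∧
    g⁻¹.lam = -rowLeft (g.sp⁻¹ : Matrix.symplecticGroup (Fin n) ℝ) g.lam g.mu ∧
    g⁻¹.mu = -rowRight (g.sp⁻¹ : Matrix.symplecticGroup (Fin n) ℝ) g.lam g.mu ∧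
    g⁻¹.kappa = -g.kappaᵀ := ⟨rfl, rfl, rfl, rfl⟩

instance : Group (JacobiGroup n m) where
  mul_assoc a b c := by
    have hp := row_pairing c.sp.2 (rowLeft b.sp a.lam a.mu) (rowRight b.sp a.lam a.mu) b.lam b.mu
    ext1
    · simp only [JacobiGroup.mul_def, mul_assoc]
    · simp only [JacobiGroup.mul_def, rowLeft_add, Submonoid.coe_mul, rowLeft_mul, add_assoc]
    · simp only [JacobiGroup.mul_def, rowRight_add, Submonoid.coe_mul, rowRight_mul, add_assoc]
    · simp only [JacobiGroup.mul_def, rowLeft_add, rowRight_add, Submonoid.coe_mul, rowLeft_mul,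
        rowRight_mul, Matrix.transpose_add, Matrix.mul_add, Matrix.add_mul]
      rw [← sub_eq_zero] at hp ⊢
      rw [← neg_eq_zero, ← hp]
      abel
  one_mul a := by
    ext1 <;> simp [JacobiGroup.mul_def, JacobiGroup.one_def, rowLeft, rowRight]
  mul_one a := by
    ext1 <;> simp [JacobiGroup.mul_def, JacobiGroup.one_def, rowLeft_one, rowRight_one]
  inv_mul_cancel a := by
    have hl : rowLeft a.sp (rowLeft (a.sp⁻¹ : Matrix.symplecticGroup (Fin n) ℝ) a.lam a.mu)
        (rowRight (a.sp⁻¹ : Matrix.symplecticGroup (Fin n) ℝ) a.lam a.mu) = a.lam := by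
      rw [← rowLeft_mul, ← Submonoid.coe_mul, inv_mul_cancel, Submonoid.coe_one, rowLeft_one]
    have hr : rowRight a.sp (rowLeft (a.sp⁻¹ : Matrix.symplecticGroup (Fin n) ℝ) a.lam a.mu)
        (rowRight (a.sp⁻¹ : Matrix.symplecticGroup (Fin n) ℝ) a.lam a.mu) = a.mu := by
      rw [← rowRight_mul, ← Submonoid.coe_mul, inv_mul_cancel, Submonoid.coe_one, rowRight_one]
    ext1
    · simp [JacobiGroup.mul_def, JacobiGroup.one_def, JacobiGroup.inv_def]
    · simp [JacobiGroup.mul_def, JacobiGroup.one_def, JacobiGroup.inv_def, rowLeft_neg, hl]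
    · simp [JacobiGroup.mul_def, JacobiGroup.one_def, JacobiGroup.inv_def, rowRight_neg, hr]
    · simp only [JacobiGroup.mul_def, JacobiGroup.one_def, JacobiGroup.inv_def, rowLeft_neg,
        rowRight_neg, hl, hr]
      have h := a.symm
      rw [Matrix.IsSymm] at h
      simp only [Matrix.transpose_add, Matrix.transpose_mul, Matrix.transpose_transpose] at h
      rw [← sub_eq_zero] at h
      rw [← neg_eq_zero, ← h]
      simp only [Matrix.neg_mul]
      abel

end Group

/-! ### The Siegel-Jacobi space and the action -/

section Space

variable (n m : ℕ)

/-- The complex vector space of symmetric `n × n` matrices. -/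
def SymMat : Submodule ℂ (Fin n → Fin n → ℂ) where
  carrier := {Z | (Matrix.of Z).IsSymm}
  add_mem' ha hb := Matrix.IsSymm.add ha hb
  zero_mem' := Matrix.isSymm_zero
  smul_mem' c _ ha := Matrix.IsSymm.smul ha c

/-- The ambient complex vector space of pairs `(Z, W)`, `Z` symmetric of size `n × n` and `W` of
size `m × n`. Matrices are written as functions of two indices here, because these carry a norm. -/
abbrev Ambient : Type := SymMat n × (Fin m → Fin n → ℂ)

variable {n m}

/-- A real matrix seen as a complex matrix. -/
def toC {a b : ℕ} (X : Matrix (Fin a) (Fin b) ℝ) : Matrix (Fin a) (Fin b) ℂ :=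
  X.map Complex.ofReal

/-- The variable `Z`. -/
def Zc (p : Ambient n m) : Matrix (Fin n) (Fin n) ℂ := Matrix.of p.1.1

/-- The variable `W`. -/
def Wc (p : Ambient n m) : Matrix (Fin m) (Fin n) ℂ := Matrix.of p.2

/-- The Siegel-Jacobi space `ℍ_n × ℂ^{(m,n)}`, an open subset of `Ambient n m`. -/
def space (n m : ℕ) : Set (Ambient n m) := {p | ((Zc p).map Complex.im).PosDef}

/-- `Y = Im Z`, as a complex matrix. -/
def Y (p : Ambient n m) : Matrix (Fin n) (Fin n) ℂ := toC ((Zc p).map Complex.im)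

/-- `V = Im W`, as a complex matrix. -/
def V (p : Ambient n m) : Matrix (Fin m) (Fin n) ℂ := toC ((Wc p).map Complex.im)

/-- `A Z + B`. -/
def num (g : JacobiGroup n m) (p : Ambient n m) : Matrix (Fin n) (Fin n) ℂ :=
  toC g.sp.1.toBlocks₁₁ * Zc p + toC g.sp.1.toBlocks₁₂

/-- `C Z + D`. -/
def den (g : JacobiGroup n m) (p : Ambient n m) : Matrix (Fin n) (Fin n) ℂ :=
  toC g.sp.1.toBlocks₂₁ * Zc p + toC g.sp.1.toBlocks₂₂

/-- `W + lam Z + mu`. -/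
def shiftW (g : JacobiGroup n m) (p : Ambient n m) : Matrix (Fin m) (Fin n) ℂ :=
  Wc p + toC g.lam * Zc p + toC g.mu

theorem toC_mul {a b c : ℕ} (X : Matrix (Fin a) (Fin b) ℝ) (X' : Matrix (Fin b) (Fin c) ℝ) :
    toC (X * X') = toC X * toC X' := Matrix.map_mul (f := Complex.ofRealHom)

theorem toC_add {a b : ℕ} (X X' : Matrix (Fin a) (Fin b) ℝ) : toC (X + X') = toC X + toC X' :=
  Matrix.map_add Complex.ofReal Complex.ofReal_add X X'

theorem toC_transpose {a b : ℕ} (X : Matrix (Fin a) (Fin b) ℝ) : toC Xᵀ = (toC X)ᵀ := rfl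

theorem toC_one {a : ℕ} : toC (1 : Matrix (Fin a) (Fin a) ℝ) = 1 :=
  Matrix.map_one Complex.ofReal Complex.ofReal_zero Complex.ofReal_one

theorem isSymm_frac (g : JacobiGroup n m) (p : Ambient n m) :
    (num g p * (den g p)⁻¹).IsSymm := by
  have hZ : (Zc p)ᵀ = Zc p := p.1.2
  by_cases hd : IsUnit (den g p).det
  · have hS := SymplecticGroup.transpose_mem g.sp.2
    obtain ⟨h1, h2, h3, h4⟩ := block_relations hS
    have t11 : ((g.sp : Matrix (Fin n ⊕ Fin n) (Fin n ⊕ Fin n) ℝ)ᵀ).toBlocks₁₁ =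
      g.sp.1.toBlocks₁₁ᵀ := rfl
    have t12 : ((g.sp : Matrix (Fin n ⊕ Fin n) (Fin n ⊕ Fin n) ℝ)ᵀ).toBlocks₁₂ =
      g.sp.1.toBlocks₂₁ᵀ := rfl
    have t21 : ((g.sp : Matrix (Fin n ⊕ Fin n) (Fin n ⊕ Fin n) ℝ)ᵀ).toBlocks₂₁ =
      g.sp.1.toBlocks₁₂ᵀ := rfl
    have t22 : ((g.sp : Matrix (Fin n ⊕ Fin n) (Fin n ⊕ Fin n) ℝ)ᵀ).toBlocks₂₂ =
      g.sp.1.toBlocks₂₂ᵀ := rfl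
    rw [t11, t12, Matrix.transpose_transpose, Matrix.transpose_transpose] at h1
    rw [t21, t22, Matrix.transpose_transpose, Matrix.transpose_transpose] at h2
    rw [t11, t12, t21, t22, Matrix.transpose_transpose, Matrix.transpose_transpose] at h3
    rw [t11, t12, t21, t22, Matrix.transpose_transpose, Matrix.transpose_transpose] at h4
    replace h1 := congrArg toC h1
    replace h2 := congrArg toC h2
    replace h3 := congrArg toC h3
    replace h4 := congrArg toC h4
    simp only [toC_mul, toC_add, toC_one, toC_transpose] at h1 h2 h3 h4
    have key : (den g p)ᵀ * num g p = (num g p)ᵀ * den g p := by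
      simp only [num, den, Matrix.transpose_add, Matrix.transpose_mul, hZ, Matrix.add_mul,
        Matrix.mul_add]
      have e1 : Zc p * (toC g.sp.1.toBlocks₂₁)ᵀ * (toC g.sp.1.toBlocks₁₁ * Zc p) =
          Zc p * (toC g.sp.1.toBlocks₁₁)ᵀ * (toC g.sp.1.toBlocks₂₁ * Zc p) := by
        rw [Matrix.mul_assoc, ← Matrix.mul_assoc (toC g.sp.1.toBlocks₂₁)ᵀ, ← h1]
        simp only [Matrix.mul_assoc]
      have e2 : (toC g.sp.1.toBlocks₂₂)ᵀ * (toC g.sp.1.toBlocks₁₁ * Zc p) =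
          Zc p + (toC g.sp.1.toBlocks₁₂)ᵀ * (toC g.sp.1.toBlocks₂₁ * Zc p) := by
        rw [← Matrix.mul_assoc, h4, Matrix.add_mul, Matrix.one_mul, Matrix.mul_assoc]
      have e3 : Zc p * (toC g.sp.1.toBlocks₁₁)ᵀ * toC g.sp.1.toBlocks₂₂ =
          Zc p + Zc p * (toC g.sp.1.toBlocks₂₁)ᵀ * toC g.sp.1.toBlocks₁₂ := by
        rw [Matrix.mul_assoc, h3, Matrix.mul_add, Matrix.mul_one, Matrix.mul_assoc]
      rw [e1, e2, e3, ← h2]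
      abel
    have hdt : IsUnit ((den g p)ᵀ).det := by rwa [Matrix.det_transpose]
    rw [Matrix.IsSymm, Matrix.transpose_mul, Matrix.transpose_nonsing_inv]
    calc ((den g p)ᵀ)⁻¹ * (num g p)ᵀ
        = ((den g p)ᵀ)⁻¹ * ((num g p)ᵀ * den g p) * (den g p)⁻¹ := by
          rw [Matrix.mul_assoc, Matrix.mul_nonsing_inv_cancel_right _ _ hd]
      _ = num g p * (den g p)⁻¹ := by
          rw [← key, ← Matrix.mul_assoc, Matrix.nonsing_inv_mul _ hdt, Matrix.one_mul]
  · rw [Matrix.nonsing_inv_apply_not_isUnit _ hd, Matrix.mul_zero]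
    exact Matrix.isSymm_zero

/-- The action `g · (Z, W) = ((A Z + B)(C Z + D)⁻¹, (W + lam Z + mu)(C Z + D)⁻¹)`. -/
def act (g : JacobiGroup n m) (p : Ambient n m) : Ambient n m :=
  (⟨Matrix.of.symm (num g p * (den g p)⁻¹), isSymm_frac g p⟩,
    Matrix.of.symm (shiftW g p * (den g p)⁻¹))

/-! ### Jacobi forms -/

/-- The automorphy factor of weight `k` and index `M`:
`det (C Z + D) ^ k * exp (2 π i Tr (M (W + lam Z + mu)(C Z + D)⁻¹ C (W + lam Z + mu)ᵀ -
  M (lam Z lamᵀ + 2 lam Wᵀ + kappa + mu lamᵀ)))`. -/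
def autFactor (k : ℤ) (M : Matrix (Fin m) (Fin m) ℝ) (g : JacobiGroup n m) (p : Ambient n m) :
    ℂ :=
  (den g p).det ^ k * Complex.exp (2 * Real.pi * Complex.I *
    (toC M * (shiftW g p * (den g p)⁻¹ * toC g.sp.1.toBlocks₂₁ * (shiftW g p)ᵀ) -
      toC M * (toC g.lam * Zc p * (toC g.lam)ᵀ + (2 : ℂ) • (toC g.lam * (Wc p)ᵀ) +
        toC g.kappa + toC g.mu * (toC g.lam)ᵀ)).trace)

/-- Half-integral matrices: integers on the diagonal, halves of integers off it. -/
def IsHalfIntegral (M : Matrix (Fin m) (Fin m) ℝ) : Prop :=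
  (∀ i, ∃ a : ℤ, M i i = a) ∧ ∀ i j, ∃ a : ℤ, 2 * M i j = a

/-- `IsJacobiForm Γ k M f`: the function `f` on the Siegel-Jacobi space is a (not necessarily
holomorphic) Jacobi form of weight `k` and index `M` for the group `Γ`. Only the values of `f` on
`space n m` matter. -/
structure IsJacobiForm (Γ : Subgroup (JacobiGroup n m)) (k : ℤ) (M : Matrix (Fin m) (Fin m) ℝ)
    (f : Ambient n m → ℂ) : Prop where
  index_posDef : M.PosDef
  index_halfIntegral : IsHalfIntegral M
  smooth : ContDiffOn ℝ ∞ f (space n m)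
  transform : ∀ g ∈ Γ, ∀ p ∈ space n m, f (act g p) = autFactor k M g p * f p

/-! ### The differential operators -/

/-- The Wirtinger derivative `∂` of `f` at `p` along `v`: the complex-linear part of the real
differential. -/
def del (f : Ambient n m → ℂ) (p v : Ambient n m) : ℂ :=
  (1 / 2) * (fderiv ℝ f p v - Complex.I * fderiv ℝ f p (Complex.I • v))

/-- The conjugate Wirtinger derivative: the value on `v` of the conjugate-linear part of the real
differential. -/
def delBar (f : Ambient n m → ℂ) (p v : Ambient n m) : ℂ :=
  (1 / 2) * (fderiv ℝ f p v + Complex.I * fderiv ℝ f p (Complex.I • v))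

/-- The symmetric matrix `(E_ij + E_ji) / 2`. In the coordinates `z_ij`, `i ≤ j`, of a symmetric
matrix, the derivative along it is `∂/∂z_ii` if `i = j` and `(1/2) ∂/∂z_ij` if `i ≠ j`. -/
def dirZ (i j : Fin n) : Ambient n m :=
  (⟨Matrix.of.symm ((1 / 2 : ℂ) • (Matrix.single i j 1 + Matrix.single j i 1)), by
    change Matrix.transpose _ = _
    simp [add_comm]⟩, 0)

/-- The unit vector of the coordinate `w_ij`. -/
def dirW (i : Fin m) (j : Fin n) : Ambient n m := (0, Matrix.of.symm (Matrix.single i j 1))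

/-- `∂f/∂Z`, with entries `∂f/∂z_ii` and `(1/2) ∂f/∂z_ij` for `i ≠ j`. -/
def dZ (f : Ambient n m → ℂ) (p : Ambient n m) : Matrix (Fin n) (Fin n) ℂ :=
  Matrix.of fun i j => del f p (dirZ i j)

/-- `∂f/∂Z̄`. -/
def dZbar (f : Ambient n m → ℂ) (p : Ambient n m) : Matrix (Fin n) (Fin n) ℂ :=
  Matrix.of fun i j => delBar f p (dirZ i j)

/-- `∂f/∂W`, the `n × m` matrix with entry `∂f/∂w_ij` in place `(j, i)`. -/
def dW (f : Ambient n m → ℂ) (p : Ambient n m) : Matrix (Fin n) (Fin m) ℂ :=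
  Matrix.of fun j i => del f p (dirW i j)

/-- `∂f/∂W̄`, the `n × m` matrix with entry `∂f/∂w̄_ij` in place `(j, i)`. -/
def dWbar (f : Ambient n m → ℂ) (p : Ambient n m) : Matrix (Fin n) (Fin m) ℂ :=
  Matrix.of fun j i => delBar f p (dirW i j)

/-- `(∂/∂W) M⁻¹ (∂f/∂W)ᵀ`, the `n × n` matrix with entries
`∑ i j, (M⁻¹)_ij ∂²f/∂w_ik ∂w_jl` in place `(k, l)`. -/
def ddW (M : Matrix (Fin m) (Fin m) ℝ) (f : Ambient n m → ℂ) (p : Ambient n m) :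
    Matrix (Fin n) (Fin n) ℂ :=
  Matrix.of fun k l => ∑ i, ∑ j,
    ((M⁻¹ i j : ℝ) : ℂ) * del (fun q => del f q (dirW j l)) p (dirW i k)

open Complex (I) in
/-- The raising operator `D₁`: the determinant of the `n` columns (one for each row of `W`) chosen
by `σ` of the `n × m` matrix `∂f/∂W + 4πi Y⁻¹ Vᵀ M f`. -/
def raise1 (M : Matrix (Fin m) (Fin m) ℝ) (σ : Fin n ↪ Fin m) (f : Ambient n m → ℂ)
    (p : Ambient n m) : ℂ :=
  ((dW f p + (4 * Real.pi * I * f p) • ((Y p)⁻¹ * (V p)ᵀ * toC M)).submatrix id σ).det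

/-- The lowering operator `δ₁`: the determinant of `(∂f/∂W̄) Y`, after choosing by `σ` `n` columns
(one for each row of `W`) of the `n × m` matrix `∂f/∂W̄`. -/
def lower1 (σ : Fin n ↪ Fin m) (f : Ambient n m → ℂ) (p : Ambient n m) : ℂ :=
  ((dWbar f p).submatrix id σ * Y p).det

open Complex (I) in
/-- The generalized heat operator
`det (-8πi ∂f/∂Z + (∂/∂W) M⁻¹ (∂f/∂W)ᵀ - 4πk f Y⁻¹ + 2mπ f Y⁻¹)`. -/
def heat (k : ℤ) (M : Matrix (Fin m) (Fin m) ℝ) (f : Ambient n m → ℂ) (p : Ambient n m) : ℂ :=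
  (-(8 * Real.pi * I) • dZ f p + ddW M f p - (4 * Real.pi * k * f p) • (Y p)⁻¹ +
    (2 * m * Real.pi * f p) • (Y p)⁻¹).det

open Complex (I) in
/-- The raising operator `D₂`:
`det (∂f/∂Z - (ik/2) f Y⁻¹ + 2πi Y⁻¹VᵀMVY⁻¹ f + (1/2) (∂f/∂W) V Y⁻¹ + (1/2) Y⁻¹ Vᵀ (∂f/∂W)ᵀ)`. -/
def raise2 (k : ℤ) (M : Matrix (Fin m) (Fin m) ℝ) (f : Ambient n m → ℂ) (p : Ambient n m) : ℂ :=
  (dZ f p - (I * k / 2 * f p) • (Y p)⁻¹ +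
    (2 * Real.pi * I * f p) • ((Y p)⁻¹ * (V p)ᵀ * toC M * V p * (Y p)⁻¹) +
    (1 / 2 : ℂ) • (dW f p * V p * (Y p)⁻¹) + (1 / 2 : ℂ) • ((Y p)⁻¹ * (V p)ᵀ * (dW f p)ᵀ)).det

/-- The lowering operator `δ₂`:
`det (Y (∂f/∂Z̄) Y + (1/2) Y (∂f/∂W̄) V + (1/2) Vᵀ (∂f/∂W̄)ᵀ Y)`. -/
def lower2 (f : Ambient n m → ℂ) (p : Ambient n m) : ℂ :=
  (Y p * dZbar f p * Y p + (1 / 2 : ℂ) • (Y p * dWbar f p * V p) +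
    (1 / 2 : ℂ) • ((V p)ᵀ * (dWbar f p)ᵀ * Y p)).det

end Space

end SiegelJacobi

end

/-! Each operator is the determinant of a matrix built from `f` and its derivatives. Fix `g`, write
`d = CZ + D`, and let `J` be the automorphy factor. It is enough to show that under `g` the matrix
is multiplied by `J` and moved by `d`: from `E` to `J dE` for `D₁`, `J dEdᵗ` for `L` and `D₂`, and
`J d⁻ᵗEd⁻¹` for `δ₂`. For `δ₁` the gradient supplies `d̄` on the left and `Y` supplies `d̄⁻ᵗ` and
`d⁻¹`, so the determinants of `d̄` cancel. Taking determinants gives `Jⁿ det(d)ᵉ`, and `Jⁿ` is the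
factor of weight `nk` and index `nM`.

All failures of covariance are expressed by two functions, the symmetric matrix `N = d⁻¹C` (`slope`)
and `R = λ - (W + λZ + μ)N` (`offset`). The differential of the action sends `(U, X)` to `(d⁻ᵗUd⁻¹,
(X + RU)d⁻¹)`. The logarithmic derivative of `J` is `k Tr(NU) - 2πi Tr(RᵗMRU) - 4πi Tr(RᵗMX)`.
Solving the chain rule for the gradients gives `gradient_act` and `gradientBar_act`; differentiating
once more along `W` gives `ddW_act`.

On the other side, `Y⁻¹` becomes `d(Y⁻¹ - 2iN)dᵗ` (`Y_act_inv`) and `VY⁻¹` becomes `(VY⁻¹ + R)dᵗ`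
(`V_act_mul_Y_act_inv`). The correction terms in the operators are the combinations of these that
cancel every `N` and `R`. In the lowering operators `J` is holomorphic and is not differentiated, so
only `R̄` has to be cancelled; since `VY⁻¹` is real, conjugating its law provides this. -/

open scoped ContDiff Matrix

noncomputable section

namespace SiegelJacobi

open Complex (I)
open scoped ComplexOrder
open Filter Topology

/-! ### Entrywise conjugation and positive definiteness -/

section Conj

variable {a b c : ℕ}

/-- The entrywise complex conjugate of a matrix. -/
def conjM (X : Matrix (Fin a) (Fin b) ℂ) : Matrix (Fin a) (Fin b) ℂ := X.map (starRingEnd ℂ)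

theorem conjM_mul (X : Matrix (Fin a) (Fin b) ℂ) (X' : Matrix (Fin b) (Fin c) ℂ) :
    conjM (X * X') = conjM X * conjM X' := Matrix.map_mul

theorem conjM_add (X X' : Matrix (Fin a) (Fin b) ℂ) : conjM (X + X') = conjM X + conjM X' :=
  Matrix.map_add _ (map_add _) X X'

theorem conjM_transpose (X : Matrix (Fin a) (Fin b) ℂ) : conjM Xᵀ = (conjM X)ᵀ := rfl

theorem conjTranspose_eq (X : Matrix (Fin a) (Fin b) ℂ) : Xᴴ = (conjM X)ᵀ := rfl

theorem conjM_toC (X : Matrix (Fin a) (Fin b) ℝ) : conjM (toC X) = toC X := by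
  ext i j
  simp [conjM, toC]

theorem conjM_conjM (X : Matrix (Fin a) (Fin b) ℂ) : conjM (conjM X) = X := by
  ext i j
  simp [conjM]

theorem conjM_one : conjM (1 : Matrix (Fin a) (Fin a) ℂ) = 1 :=
  Matrix.map_one _ (map_zero _) (map_one _)

theorem det_conjM (X : Matrix (Fin a) (Fin a) ℂ) :
    (conjM X).det = (starRingEnd ℂ) X.det :=
  (RingHom.map_det (starRingEnd ℂ) X).symm

theorem sub_conjM (X : Matrix (Fin a) (Fin b) ℂ) :
    X - conjM X = (2 * I) • toC (X.map Complex.im) := by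
  ext i j
  simp only [conjM, toC, Matrix.sub_apply, Matrix.map_apply, Matrix.smul_apply, smul_eq_mul]
  rw [Complex.sub_conj]
  push_cast
  ring

/-- The real part of the Hermitian form at `x` is the sum of the real form at `Re x` and at `Im x`,
one of which is nonzero. This allows `Y` to be tested on complex vectors and moved by the complex
matrix `d`. -/
theorem posDef_toC {X : Matrix (Fin a) (Fin a) ℝ} (h : X.PosDef) : (toC X).PosDef := by
  have hX : (toC X).IsHermitian := by
    rw [Matrix.IsHermitian, conjTranspose_eq, conjM_toC, ← toC_transpose]
    exact congrArg toC h.isHermitian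
  refine Matrix.PosDef.of_dotProduct_mulVec_pos hX fun x hx => ?_
  rw [Complex.pos_iff]
  refine ⟨?_, (hX.im_star_dotProduct_mulVec_self x).symm⟩
  have key : (star x ⬝ᵥ toC X *ᵥ x).re =
      (fun i => (x i).re) ⬝ᵥ X *ᵥ (fun i => (x i).re) +
      (fun i => (x i).im) ⬝ᵥ X *ᵥ (fun i => (x i).im) := by
    simp only [dotProduct, Matrix.mulVec, toC, Finset.mul_sum, Complex.re_sum,
      ← Finset.sum_add_distrib]
    refine Finset.sum_congr rfl fun i _ => Finset.sum_congr rfl fun j _ => ?_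
    simp
  have h1 := h.posSemidef.dotProduct_mulVec_nonneg (fun i => (x i).re)
  have h2 := h.posSemidef.dotProduct_mulVec_nonneg (fun i => (x i).im)
  simp only [star_trivial] at h1 h2
  rw [key]
  by_cases h0 : (fun i => (x i).re) = 0
  · have h3 : (fun i => (x i).im) ≠ 0 := fun h3 => hx (by
      ext i
      exact Complex.ext (congrFun h0 i) (congrFun h3 i))
    have := h.dotProduct_mulVec_pos h3
    simp only [star_trivial] at this
    linarith
  · have := h.dotProduct_mulVec_pos h0
    simp only [star_trivial] at this
    linarith

theorem posDef_of_posDef_toC {X : Matrix (Fin a) (Fin a) ℝ} (h : (toC X).PosDef) : X.PosDef := by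
  refine Matrix.PosDef.of_dotProduct_mulVec_pos ?_ fun x hx => ?_
  · have := h.isHermitian
    ext i j
    have h' := congrFun (congrFun this i) j
    simpa [toC] using h'
  · have h1 := h.dotProduct_mulVec_pos (x := fun i => (x i : ℂ)) (fun h0 => hx (by
      ext i
      exact Complex.ofReal_eq_zero.mp (congrFun h0 i)))
    have h2 := (Complex.pos_iff.mp h1).1
    have h3 : (star (fun i => (x i : ℂ)) ⬝ᵥ toC X *ᵥ fun i => (x i : ℂ)).re =
        star x ⬝ᵥ X *ᵥ x := by
      simp [dotProduct, Matrix.mulVec, toC, Finset.mul_sum]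
    rwa [h3] at h2

end Conj

/-! ### Algebra of the action -/

section Algebra

variable {n m : ℕ}

theorem Zc_symm (p : Ambient n m) : (Zc p)ᵀ = Zc p := p.1.2

theorem Zc_sub_conjM (p : Ambient n m) : Zc p - conjM (Zc p) = (2 * I) • Y p := sub_conjM _

theorem Wc_sub_conjM (p : Ambient n m) : Wc p - conjM (Wc p) = (2 * I) • V p := sub_conjM _

theorem Y_symm (p : Ambient n m) : (Y p)ᵀ = Y p := by
  have h := Zc_symm p
  ext i j
  have h' := congrFun (congrFun h i) j
  rw [Matrix.transpose_apply] at h'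
  simp [Y, toC, h']

theorem conjM_Y (p : Ambient n m) : conjM (Y p) = Y p := conjM_toC _

theorem conjM_V (p : Ambient n m) : conjM (V p) = V p := conjM_toC _

theorem isUnit_det_Y {p : Ambient n m} (hp : p ∈ space n m) : IsUnit (Y p).det :=
  (Matrix.isUnit_iff_isUnit_det _).mp (posDef_toC hp).isUnit

/-- The first four come from the transpose of `S`, which is again symplectic; the last comes from
`S` itself and serves the symmetry of `slope`. -/
theorem complex_block_relations (g : JacobiGroup n m) :
    ((toC g.sp.1.toBlocks₁₁)ᵀ * toC g.sp.1.toBlocks₂₁ =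
      (toC g.sp.1.toBlocks₂₁)ᵀ * toC g.sp.1.toBlocks₁₁) ∧
    ((toC g.sp.1.toBlocks₁₂)ᵀ * toC g.sp.1.toBlocks₂₂ =
      (toC g.sp.1.toBlocks₂₂)ᵀ * toC g.sp.1.toBlocks₁₂) ∧
    ((toC g.sp.1.toBlocks₁₁)ᵀ * toC g.sp.1.toBlocks₂₂ =
      1 + (toC g.sp.1.toBlocks₂₁)ᵀ * toC g.sp.1.toBlocks₁₂) ∧
    ((toC g.sp.1.toBlocks₂₂)ᵀ * toC g.sp.1.toBlocks₁₁ =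
      1 + (toC g.sp.1.toBlocks₁₂)ᵀ * toC g.sp.1.toBlocks₂₁) ∧
    (toC g.sp.1.toBlocks₂₁ * (toC g.sp.1.toBlocks₂₂)ᵀ =
      toC g.sp.1.toBlocks₂₂ * (toC g.sp.1.toBlocks₂₁)ᵀ) := by
  obtain ⟨h1, h2, h3, h4⟩ := block_relations (SymplecticGroup.transpose_mem g.sp.2)
  have h5 := (block_relations g.sp.2).2.1
  have t11 : ((g.sp : Matrix (Fin n ⊕ Fin n) (Fin n ⊕ Fin n) ℝ)ᵀ).toBlocks₁₁ =
    g.sp.1.toBlocks₁₁ᵀ := rfl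
  have t12 : ((g.sp : Matrix (Fin n ⊕ Fin n) (Fin n ⊕ Fin n) ℝ)ᵀ).toBlocks₁₂ =
    g.sp.1.toBlocks₂₁ᵀ := rfl
  have t21 : ((g.sp : Matrix (Fin n ⊕ Fin n) (Fin n ⊕ Fin n) ℝ)ᵀ).toBlocks₂₁ =
    g.sp.1.toBlocks₁₂ᵀ := rfl
  have t22 : ((g.sp : Matrix (Fin n ⊕ Fin n) (Fin n ⊕ Fin n) ℝ)ᵀ).toBlocks₂₂ =
    g.sp.1.toBlocks₂₂ᵀ := rfl
  simp only [t11, t12, t21, t22, Matrix.transpose_transpose] at h1 h2 h3 h4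
  replace h1 := congrArg toC h1
  replace h2 := congrArg toC h2
  replace h3 := congrArg toC h3
  replace h4 := congrArg toC h4
  replace h5 := congrArg toC h5
  simp only [toC_mul, toC_add, toC_one, toC_transpose] at h1 h2 h3 h4 h5
  exact ⟨h1, h2, h3, h4, h5⟩

/-- The polarized symplectic relation for `A Z + B` and `C Z + D` at two symmetric matrices. -/
theorem polarized_relation (g : JacobiGroup n m) (Z₁ Z₂ : Matrix (Fin n) (Fin n) ℂ)
    (h : Z₁ᵀ = Z₁) :
    (toC g.sp.1.toBlocks₂₁ * Z₁ + toC g.sp.1.toBlocks₂₂)ᵀ *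
        (toC g.sp.1.toBlocks₁₁ * Z₂ + toC g.sp.1.toBlocks₁₂) -
      (toC g.sp.1.toBlocks₁₁ * Z₁ + toC g.sp.1.toBlocks₁₂)ᵀ *
        (toC g.sp.1.toBlocks₂₁ * Z₂ + toC g.sp.1.toBlocks₂₂) = Z₂ - Z₁ := by
  obtain ⟨h1, h2, h3, h4, -⟩ := complex_block_relations g
  generalize toC g.sp.1.toBlocks₁₁ = A at *
  generalize toC g.sp.1.toBlocks₁₂ = B at *
  generalize toC g.sp.1.toBlocks₂₁ = C at *
  generalize toC g.sp.1.toBlocks₂₂ = D at *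
  have e : (C * Z₁ + D)ᵀ * (A * Z₂ + B) - (A * Z₁ + B)ᵀ * (C * Z₂ + D) =
      Z₁ * (Cᵀ * A - Aᵀ * C) * Z₂ + Z₁ * (Cᵀ * B - Aᵀ * D) + (Dᵀ * A - Bᵀ * C) * Z₂ +
        (Dᵀ * B - Bᵀ * D) := by
    simp only [Matrix.transpose_add, Matrix.transpose_mul, h, Matrix.mul_add, Matrix.add_mul,
      Matrix.mul_sub, Matrix.sub_mul, Matrix.mul_assoc]
    abel
  rw [e, h1, h2, h3, h4]
  simp only [sub_self, Matrix.mul_zero, Matrix.zero_mul, add_sub_cancel_right, Matrix.one_mul,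
    sub_add_cancel_right, Matrix.mul_neg, Matrix.mul_one]
  abel

theorem Zc_act (g : JacobiGroup n m) (p : Ambient n m) :
    Zc (act g p) = num g p * (den g p)⁻¹ := rfl

theorem Wc_act (g : JacobiGroup n m) (p : Ambient n m) :
    Wc (act g p) = shiftW g p * (den g p)⁻¹ := rfl

theorem conjM_den (g : JacobiGroup n m) (p : Ambient n m) :
    conjM (den g p) = toC g.sp.1.toBlocks₂₁ * conjM (Zc p) + toC g.sp.1.toBlocks₂₂ := by
  rw [den, conjM_add, conjM_mul, conjM_toC, conjM_toC]

theorem conjM_num (g : JacobiGroup n m) (p : Ambient n m) :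
    conjM (num g p) = toC g.sp.1.toBlocks₁₁ * conjM (Zc p) + toC g.sp.1.toBlocks₁₂ := by
  rw [num, conjM_add, conjM_mul, conjM_toC, conjM_toC]

/-- The polarized relation at `Z̄` and `Z`. It yields both the invertibility of `CZ + D` and the
transformation of `Y`. -/
theorem conjM_den_transpose_mul_num (g : JacobiGroup n m) (p : Ambient n m) :
    (conjM (den g p))ᵀ * num g p - (conjM (num g p))ᵀ * den g p = (2 * I) • Y p := by
  rw [conjM_den, conjM_num, num, den, polarized_relation, Zc_sub_conjM]
  rw [← conjM_transpose, Zc_symm]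

/-- If `dv = 0`, placing the preceding identity between `v*` and `v` kills both terms on its left,
so `v*Yv = 0`, against `Y > 0`. -/
theorem isUnit_det_den (g : JacobiGroup n m) {p : Ambient n m} (hp : p ∈ space n m) :
    IsUnit (den g p).det := by
  rw [isUnit_iff_ne_zero]
  intro h0
  obtain ⟨v, hv, hv0⟩ := Matrix.exists_mulVec_eq_zero_iff.mpr h0
  have h1 := congrArg (fun X => star v ⬝ᵥ X *ᵥ v) (conjM_den_transpose_mul_num g p)
  simp only [Matrix.sub_mulVec, ← Matrix.mulVec_mulVec, hv0, Matrix.mulVec_zero, sub_zero,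
    Matrix.smul_mulVec, dotProduct_smul] at h1
  rw [← conjTranspose_eq, Matrix.dotProduct_mulVec, ← Matrix.star_mulVec, hv0, star_zero,
    zero_dotProduct] at h1
  have h2 := (posDef_toC hp).dotProduct_mulVec_pos hv
  have h3 : star v ⬝ᵥ Y p *ᵥ v = 0 := by
    simpa using h1.symm
  exact h2.ne' h3

/-- With `Z'` the symmetric image of `Z` and `AZ + B = Z'd`, the left side of the preceding relation
is `d̄ᵗ(Z' - Z̄')d`. -/
theorem Y_act_conj (g : JacobiGroup n m) {p : Ambient n m} (hp : p ∈ space n m) :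
    (conjM (den g p))ᵀ * Y (act g p) * den g p = Y p := by
  have hd := isUnit_det_den g hp
  have hI : (2 * I) ≠ 0 := by simp
  apply smul_right_injective _ hI
  have hc : IsUnit ((conjM (den g p))ᵀ).det := by
    rw [Matrix.det_transpose, det_conjM]; exact hd.map _
  have hs : (conjM (Zc (act g p))) = ((conjM (den g p))ᵀ)⁻¹ * (conjM (num g p))ᵀ := by
    have h1 : Zc (act g p) * den g p = num g p := by
      rw [Zc_act, Matrix.mul_assoc, Matrix.nonsing_inv_mul _ hd, Matrix.mul_one]
    rw [← h1, conjM_mul, Matrix.transpose_mul, ← Matrix.mul_assoc, Matrix.nonsing_inv_mul _ hc,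
      Matrix.one_mul, ← conjM_transpose, Zc_symm]
  change (2 * I) • ((conjM (den g p))ᵀ * Y (act g p) * den g p) = (2 * I) • Y p
  rw [← conjM_den_transpose_mul_num g p, ← Matrix.smul_mul, ← Matrix.mul_smul, ← Zc_sub_conjM,
    hs, Zc_act, Matrix.mul_sub, Matrix.sub_mul, ← Matrix.mul_assoc, ← Matrix.mul_assoc,
    Matrix.mul_nonsing_inv _ hc, Matrix.one_mul, Matrix.mul_assoc _ _ (den g p),
    Matrix.nonsing_inv_mul _ hd, Matrix.mul_one]

theorem act_mem_space (g : JacobiGroup n m) {p : Ambient n m} (hp : p ∈ space n m) :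
    act g p ∈ space n m := by
  have hd := isUnit_det_den g hp
  apply posDef_of_posDef_toC
  have h := Y_act_conj g hp
  rw [← conjTranspose_eq] at h
  have hu : IsUnit (den g p) := (Matrix.isUnit_iff_isUnit_det _).mpr hd
  rw [← Matrix.IsUnit.posDef_star_left_conjugate_iff hu]
  have : (Y p).PosDef := posDef_toC hp
  rwa [← h] at this

/-- `(C Z + D)⁻¹ C`. -/
def slope (g : JacobiGroup n m) (p : Ambient n m) : Matrix (Fin n) (Fin n) ℂ :=
  (den g p)⁻¹ * toC g.sp.1.toBlocks₂₁

/-- `lam - (W + lam Z + mu) (C Z + D)⁻¹ C`. -/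
def offset (g : JacobiGroup n m) (p : Ambient n m) : Matrix (Fin m) (Fin n) ℂ :=
  toC g.lam - shiftW g p * slope g p

/-- Since `CDᵗ = DCᵗ` and `Z` is symmetric, `Cdᵗ = dCᵗ`; multiply by the inverses of `d` and `dᵗ`.
-/
theorem slope_symm (g : JacobiGroup n m) {p : Ambient n m} (hp : p ∈ space n m) :
    (slope g p)ᵀ = slope g p := by
  have hd := isUnit_det_den g hp
  have hdt : IsUnit ((den g p)ᵀ).det := by rwa [Matrix.det_transpose]
  have h : toC g.sp.1.toBlocks₂₁ * (den g p)ᵀ = den g p * (toC g.sp.1.toBlocks₂₁)ᵀ := by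
    rw [den, Matrix.transpose_add, Matrix.transpose_mul, Zc_symm, Matrix.mul_add, Matrix.add_mul,
      (complex_block_relations g).2.2.2.2, Matrix.mul_assoc]
  rw [slope, Matrix.transpose_mul, Matrix.transpose_nonsing_inv]
  calc (toC g.sp.1.toBlocks₂₁)ᵀ * ((den g p)ᵀ)⁻¹
      = (den g p)⁻¹ * (den g p * (toC g.sp.1.toBlocks₂₁)ᵀ) * ((den g p)ᵀ)⁻¹ := by
        rw [← Matrix.mul_assoc, Matrix.nonsing_inv_mul _ hd, Matrix.one_mul]
    _ = _ := by
        rw [← h, Matrix.mul_assoc, Matrix.mul_assoc, Matrix.mul_nonsing_inv _ hdt, Matrix.mul_one]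

theorem mul_den_transpose_eq (g : JacobiGroup n m) {p : Ambient n m} (hp : p ∈ space n m) :
    slope g p * (den g p)ᵀ = (toC g.sp.1.toBlocks₂₁)ᵀ := by
  have hd := isUnit_det_den g hp
  rw [← slope_symm g hp, ← Matrix.transpose_mul, slope, ← Matrix.mul_assoc,
    Matrix.mul_nonsing_inv _ hd, Matrix.one_mul]

theorem conjM_den_transpose (g : JacobiGroup n m) (p : Ambient n m) :
    (conjM (den g p))ᵀ = (den g p)ᵀ - (2 * I) • (Y p * (toC g.sp.1.toBlocks₂₁)ᵀ) := by
  have h : conjM (Zc p) = Zc p - (2 * I) • Y p := by rw [← Zc_sub_conjM]; abel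
  rw [conjM_den, h, den, Matrix.mul_sub, Matrix.mul_smul]
  simp only [Matrix.transpose_add, Matrix.transpose_sub, Matrix.transpose_smul,
    Matrix.transpose_mul, Y_symm]
  abel

/-- Eliminating `d̄ᵗ = dᵗ - 2iYCᵗ` leaves only `d` and `dᵗ` outside, the shape in which the
holomorphic gradients transform; `slope` is the resulting defect. -/
theorem Y_act_inv (g : JacobiGroup n m) {p : Ambient n m} (hp : p ∈ space n m) :
    (Y (act g p))⁻¹ = den g p * ((Y p)⁻¹ - (2 * I) • slope g p) * (den g p)ᵀ := by
  have hd := isUnit_det_den g hp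
  have hY := isUnit_det_Y hp
  have hc : IsUnit ((conjM (den g p))ᵀ).det := by
    rw [Matrix.det_transpose, det_conjM]; exact hd.map _
  have h2 : ((Y p)⁻¹ - (2 * I) • slope g p) * (den g p)ᵀ = (Y p)⁻¹ * (conjM (den g p))ᵀ := by
    rw [conjM_den_transpose, Matrix.sub_mul, Matrix.smul_mul, mul_den_transpose_eq g hp,
      Matrix.mul_sub, Matrix.mul_smul, ← Matrix.mul_assoc, Matrix.nonsing_inv_mul _ hY,
      Matrix.one_mul]
  rw [Matrix.mul_assoc, h2]
  apply Matrix.inv_eq_left_inv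
  have h1 := Y_act_conj g hp
  have h3 : (conjM (den g p))ᵀ * Y (act g p) = Y p * (den g p)⁻¹ := by
    rw [← h1, Matrix.mul_assoc _ _ (den g p)⁻¹, Matrix.mul_nonsing_inv _ hd, Matrix.mul_one]
  rw [Matrix.mul_assoc, Matrix.mul_assoc, h3, ← Matrix.mul_assoc (Y p)⁻¹,
    Matrix.nonsing_inv_mul _ hY, Matrix.one_mul, Matrix.mul_nonsing_inv _ hd]

theorem Y_act_inv' (g : JacobiGroup n m) {p : Ambient n m} (hp : p ∈ space n m) :
    (Y (act g p))⁻¹ = den g p * (Y p)⁻¹ * (conjM (den g p))ᵀ := by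
  have hY := isUnit_det_Y hp
  rw [Y_act_inv g hp, Matrix.mul_assoc, Matrix.mul_assoc, conjM_den_transpose, Matrix.sub_mul,
    Matrix.smul_mul, mul_den_transpose_eq g hp,
      Matrix.mul_sub (Y p)⁻¹, Matrix.mul_smul, ← Matrix.mul_assoc (Y p)⁻¹,
      Matrix.nonsing_inv_mul _ hY, Matrix.one_mul]

/-- Let primes denote images under `g` and `S = W + λZ + μ`. The two forms of `Y'⁻¹`, with `d̄` on
the right or on the left, give `W'Y'⁻¹ = SY⁻¹d̄ᵗ` and `W̄'Y'⁻¹ = S̄Y⁻¹dᵗ`. Subtract, using `S̄ = S -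
2i(V + λY)`, `d̄ᵗ = dᵗ - 2iYCᵗ` and `Cᵗ = Ndᵗ`. -/
theorem V_act_mul_Y_act_inv (g : JacobiGroup n m) {p : Ambient n m} (hp : p ∈ space n m) :
    V (act g p) * (Y (act g p))⁻¹ = (V p * (Y p)⁻¹ + offset g p) * (den g p)ᵀ := by
  have hd := isUnit_det_den g hp
  have hY := isUnit_det_Y hp
  have hdc : IsUnit ((conjM (den g p))).det := by
    rw [det_conjM]; exact hd.map _
  have hI : (2 * I) ≠ 0 := by simp
  apply smul_right_injective _ hI
  change (2 * I) • (V (act g p) * (Y (act g p))⁻¹) =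
    (2 * I) • ((V p * (Y p)⁻¹ + offset g p) * (den g p)ᵀ)
  have hS : conjM (shiftW g p) = shiftW g p - (2 * I) • (V p + toC g.lam * Y p) := by
    rw [shiftW, conjM_add, conjM_add, conjM_mul, conjM_toC, conjM_toC, smul_add,
      ← Matrix.mul_smul, ← Zc_sub_conjM, ← Wc_sub_conjM, Matrix.mul_sub]
    abel
  have hW : conjM (Wc (act g p)) * conjM (den g p) = conjM (shiftW g p) := by
    rw [← conjM_mul, Wc_act, Matrix.mul_assoc, Matrix.nonsing_inv_mul _ hd, Matrix.mul_one]
  have hYc : (Y (act g p))⁻¹ = conjM (den g p) * (Y p)⁻¹ * (den g p)ᵀ := by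
    have := congrArg Matrix.transpose (Y_act_inv' g hp)
    rw [Matrix.transpose_nonsing_inv, Y_symm, Matrix.transpose_mul, Matrix.transpose_mul,
      Matrix.transpose_transpose, Matrix.transpose_nonsing_inv, Y_symm] at this
    rw [this, Matrix.mul_assoc]
  have h1 : Wc (act g p) * (Y (act g p))⁻¹ = shiftW g p * (Y p)⁻¹ * (conjM (den g p))ᵀ := by
    rw [Y_act_inv' g hp, Wc_act, Matrix.mul_assoc, Matrix.mul_assoc, ← Matrix.mul_assoc _ (den g p),
      Matrix.nonsing_inv_mul _ hd, Matrix.one_mul, Matrix.mul_assoc]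
  have h2 : conjM (Wc (act g p)) * (Y (act g p))⁻¹ =
      conjM (shiftW g p) * (Y p)⁻¹ * (den g p)ᵀ := by
    rw [hYc, ← Matrix.mul_assoc, ← Matrix.mul_assoc, hW]
  have h3 : (Y p)⁻¹ * (Y p * (toC g.sp.1.toBlocks₂₁)ᵀ) = (toC g.sp.1.toBlocks₂₁)ᵀ := by
    rw [← Matrix.mul_assoc, Matrix.nonsing_inv_mul _ hY, Matrix.one_mul]
  have h4 : Y p * ((Y p)⁻¹ * (den g p)ᵀ) = (den g p)ᵀ := by
    rw [← Matrix.mul_assoc, Matrix.mul_nonsing_inv _ hY, Matrix.one_mul]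
  rw [← Matrix.smul_mul, ← Wc_sub_conjM, Matrix.sub_mul, h1, h2, hS, conjM_den_transpose, offset]
  simp only [Matrix.mul_sub, Matrix.sub_mul, Matrix.add_mul, Matrix.mul_smul, Matrix.smul_mul,
    Matrix.mul_assoc, h3, h4, mul_den_transpose_eq g hp, smul_add, smul_sub]
  abel

end Algebra

/-! ### Smooth matrix-valued functions -/

section SmoothMatrix

variable (𝕜 : Type*) [NontriviallyNormedField 𝕜] [NormedAlgebra 𝕜 ℂ]
  {E : Type*} [NormedAddCommGroup E] [NormedSpace 𝕜 E] {a b c : ℕ}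

/-- A matrix-valued function is smooth at a point if its entries are. -/
def SmoothAt (F : E → Matrix (Fin a) (Fin b) ℂ) (p : E) : Prop :=
  ∀ i j, ContDiffAt 𝕜 ∞ (fun q => F q i j) p

variable {𝕜}

theorem SmoothAt.const (X : Matrix (Fin a) (Fin b) ℂ) (p : E) : SmoothAt 𝕜 (fun _ => X) p :=
  fun _ _ => contDiffAt_const

theorem SmoothAt.add {F G : E → Matrix (Fin a) (Fin b) ℂ} {p : E} (hF : SmoothAt 𝕜 F p)
    (hG : SmoothAt 𝕜 G p) : SmoothAt 𝕜 (fun q => F q + G q) p :=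
  fun i j => (hF i j).add (hG i j)

theorem SmoothAt.sub {F G : E → Matrix (Fin a) (Fin b) ℂ} {p : E} (hF : SmoothAt 𝕜 F p)
    (hG : SmoothAt 𝕜 G p) : SmoothAt 𝕜 (fun q => F q - G q) p :=
  fun i j => (hF i j).sub (hG i j)

theorem SmoothAt.smul {h : E → ℂ} {F : E → Matrix (Fin a) (Fin b) ℂ} {p : E}
    (hh : ContDiffAt 𝕜 ∞ h p) (hF : SmoothAt 𝕜 F p) : SmoothAt 𝕜 (fun q => h q • F q) p :=
  fun i j => hh.mul (hF i j)

theorem SmoothAt.transpose {F : E → Matrix (Fin a) (Fin b) ℂ} {p : E} (hF : SmoothAt 𝕜 F p) :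
    SmoothAt 𝕜 (fun q => (F q)ᵀ) p :=
  fun i j => hF j i

theorem SmoothAt.mul {F : E → Matrix (Fin a) (Fin b) ℂ} {G : E → Matrix (Fin b) (Fin c) ℂ}
    {p : E} (hF : SmoothAt 𝕜 F p) (hG : SmoothAt 𝕜 G p) : SmoothAt 𝕜 (fun q => F q * G q) p := by
  intro i j
  simp only [Matrix.mul_apply]
  exact ContDiffAt.sum fun l _ => (hF i l).mul (hG l j)

theorem SmoothAt.trace {F : E → Matrix (Fin a) (Fin a) ℂ} {p : E} (hF : SmoothAt 𝕜 F p) :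
    ContDiffAt 𝕜 ∞ (fun q => (F q).trace) p := by
  simp only [Matrix.trace, Matrix.diag]
  exact ContDiffAt.sum fun l _ => hF l l

theorem SmoothAt.det {F : E → Matrix (Fin a) (Fin a) ℂ} {p : E} (hF : SmoothAt 𝕜 F p) :
    ContDiffAt 𝕜 ∞ (fun q => (F q).det) p := by
  simp only [Matrix.det_apply']
  exact ContDiffAt.sum fun σ _ => contDiffAt_const.mul (contDiffAt_prod fun l _ => hF _ l)

/-- Cramer's rule: each entry is a determinant with one row made constant, divided by `det F`. -/
theorem SmoothAt.inv {F : E → Matrix (Fin a) (Fin a) ℂ} {p : E} (hF : SmoothAt 𝕜 F p)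
    (h : IsUnit (F p).det) : SmoothAt 𝕜 (fun q => (F q)⁻¹) p := by
  intro i j
  simp only [Matrix.inv_def, Matrix.smul_apply, Ring.inverse_eq_inv', smul_eq_mul,
    Matrix.adjugate_apply]
  refine (hF.det.inv h.ne_zero).mul (SmoothAt.det fun r s => ?_)
  by_cases hr : r = j
  · subst hr
    simpa using contDiffAt_const
  · simpa [Matrix.updateRow_ne hr] using hF r s

end SmoothMatrix

/-! ### Derivatives of matrix-valued functions along a line -/

section LineDerivative

variable {E : Type*} [NormedAddCommGroup E] [NormedSpace ℂ E] {a b c : ℕ}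

/-- The matrix-valued function `F` has derivative `F'` at `p` along `v`, entry by entry. -/
def HasMatDeriv (F : E → Matrix (Fin a) (Fin b) ℂ) (F' : Matrix (Fin a) (Fin b) ℂ) (p v : E) :
    Prop :=
  ∀ i j, HasLineDerivAt ℂ (fun q => F q i j) (F' i j) p v

variable {p v : E}

theorem HasMatDeriv.unique {F : E → Matrix (Fin a) (Fin b) ℂ} {F' F'' : Matrix (Fin a) (Fin b) ℂ}
    (h : HasMatDeriv F F' p v) (h' : HasMatDeriv F F'' p v) : F' = F'' := by
  ext i j
  exact (h i j).unique (h' i j)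

theorem HasMatDeriv.congr_deriv {F : E → Matrix (Fin a) (Fin b) ℂ}
    {F' F'' : Matrix (Fin a) (Fin b) ℂ} (h : HasMatDeriv F F' p v) (e : F' = F'') :
    HasMatDeriv F F'' p v :=
  e ▸ h

theorem HasMatDeriv.const (X : Matrix (Fin a) (Fin b) ℂ) : HasMatDeriv (fun _ => X) 0 p v :=
  fun _ _ => hasDerivAt_const _ _

theorem HasMatDeriv.add {F G : E → Matrix (Fin a) (Fin b) ℂ} {F' G' : Matrix (Fin a) (Fin b) ℂ}
    (hF : HasMatDeriv F F' p v) (hG : HasMatDeriv G G' p v) :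
    HasMatDeriv (fun q => F q + G q) (F' + G') p v :=
  fun i j => HasDerivAt.add (hF i j) (hG i j)

theorem HasMatDeriv.sub {F G : E → Matrix (Fin a) (Fin b) ℂ} {F' G' : Matrix (Fin a) (Fin b) ℂ}
    (hF : HasMatDeriv F F' p v) (hG : HasMatDeriv G G' p v) :
    HasMatDeriv (fun q => F q - G q) (F' - G') p v :=
  fun i j => HasDerivAt.sub (hF i j) (hG i j)

theorem HasMatDeriv.const_smul {F : E → Matrix (Fin a) (Fin b) ℂ} {F' : Matrix (Fin a) (Fin b) ℂ}
    (hF : HasMatDeriv F F' p v) (r : ℂ) : HasMatDeriv (fun q => r • F q) (r • F') p v :=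
  fun i j => HasDerivAt.const_mul r (hF i j)

theorem HasMatDeriv.transpose {F : E → Matrix (Fin a) (Fin b) ℂ} {F' : Matrix (Fin a) (Fin b) ℂ}
    (hF : HasMatDeriv F F' p v) : HasMatDeriv (fun q => (F q)ᵀ) F'ᵀ p v :=
  fun i j => hF j i

theorem HasMatDeriv.mul {F : E → Matrix (Fin a) (Fin b) ℂ} {F' : Matrix (Fin a) (Fin b) ℂ}
    {G : E → Matrix (Fin b) (Fin c) ℂ} {G' : Matrix (Fin b) (Fin c) ℂ}
    (hF : HasMatDeriv F F' p v) (hG : HasMatDeriv G G' p v) :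
    HasMatDeriv (fun q => F q * G q) (F' * G p + F p * G') p v := by
  intro i j
  simp only [Matrix.mul_apply, Matrix.add_apply, ← Finset.sum_add_distrib]
  have h : ∀ l, HasDerivAt (fun t : ℂ => F (p + t • v) i l * G (p + t • v) l j)
      (F' i l * G p l j + F p i l * G' l j) 0 := fun l => by
    simpa using HasDerivAt.fun_mul (hF i l) (hG l j)
  exact HasDerivAt.fun_sum fun l _ => h l

theorem HasMatDeriv.trace {F : E → Matrix (Fin a) (Fin a) ℂ} {F' : Matrix (Fin a) (Fin a) ℂ}
    (hF : HasMatDeriv F F' p v) : HasLineDerivAt ℂ (fun q => (F q).trace) F'.trace p v := by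
  simp only [Matrix.trace, Matrix.diag]
  exact HasDerivAt.fun_sum fun l _ => hF l l

theorem SmoothAt.exists_hasMatDeriv {F : E → Matrix (Fin a) (Fin b) ℂ} (hF : SmoothAt ℂ F p)
    (v : E) : ∃ F', HasMatDeriv F F' p v :=
  ⟨Matrix.of fun i j => fderiv ℂ (fun q => F q i j) p v, fun i j =>
    ((hF i j).differentiableAt (by simp)).hasFDerivAt.hasLineDerivAt v⟩

/-- Smoothness supplies some derivative of the inverse; differentiating `F F⁻¹ = 1`, valid near `p`,
identifies it. -/
theorem HasMatDeriv.inv {F : E → Matrix (Fin a) (Fin a) ℂ} {F' : Matrix (Fin a) (Fin a) ℂ}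
    (hF : HasMatDeriv F F' p v) (hs : SmoothAt ℂ F p) (hu : IsUnit (F p).det) :
    HasMatDeriv (fun q => (F q)⁻¹) (-((F p)⁻¹ * F' * (F p)⁻¹)) p v := by
  obtain ⟨G, hG⟩ := (hs.inv hu).exists_hasMatDeriv v
  have h1 := hF.mul hG
  have hev : ∀ᶠ q in 𝓝 p, IsUnit (F q).det := by
    have := hs.det.continuousAt.eventually_ne hu.ne_zero
    filter_upwards [this] with q hq using isUnit_iff_ne_zero.mpr hq
  have h2 : HasMatDeriv (fun q => F q * (F q)⁻¹) 0 p v := fun i j => by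
    refine (HasMatDeriv.const (1 : Matrix (Fin a) (Fin a) ℂ) i j).congr_of_eventuallyEq ?_
    filter_upwards [hev] with q hq
    rw [Matrix.mul_nonsing_inv _ hq]
  have h3 := h1.unique h2
  have h4 : G = -((F p)⁻¹ * F' * (F p)⁻¹) := by
    have := congrArg (fun X => (F p)⁻¹ * X) h3
    simp only [Matrix.mul_add, Matrix.mul_zero] at this
    rw [← Matrix.mul_assoc (F p)⁻¹ (F p), Matrix.nonsing_inv_mul _ hu, Matrix.one_mul,
      ← Matrix.mul_assoc] at this
    rw [eq_neg_iff_add_eq_zero, add_comm, this]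
  rwa [← h4]

/-- The trace is the linear coefficient of the polynomial `det(1 + TX)`. -/
theorem hasDerivAt_det_one_add_smul (X : Matrix (Fin a) (Fin a) ℂ) :
    HasDerivAt (fun t : ℂ => (1 + t • X).det) X.trace 0 := by
  have h := (Matrix.det (1 + (Polynomial.X : Polynomial ℂ) • X.map Polynomial.C)).hasDerivAt 0
  rw [Matrix.derivative_det_one_add_X_smul] at h
  refine h.congr_of_eventuallyEq (Eventually.of_forall fun t => ?_)
  change _ = Polynomial.evalRingHom t _
  rw [RingHom.map_det]
  refine congrArg Matrix.det ?_
  ext i j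
  by_cases hij : i = j <;> simp [hij, mul_comm t]

end LineDerivative

/-! ### Wirtinger derivatives -/

section Wirtinger

variable {n m : ℕ}

/-- The `(i, j)` entry of `Z` as a linear functional. -/
def entryZ (i j : Fin n) : Ambient n m →L[ℂ] ℂ :=
  (ContinuousLinearMap.proj j).comp ((ContinuousLinearMap.proj (φ := fun _ => Fin n → ℂ) i).comp
    ((SymMat n).subtypeL.comp (ContinuousLinearMap.fst ℂ _ _)))

/-- The `(i, j)` entry of `W` as a linear functional. -/
def entryW (i : Fin m) (j : Fin n) : Ambient n m →L[ℂ] ℂ :=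
  (ContinuousLinearMap.proj j).comp ((ContinuousLinearMap.proj (φ := fun _ => Fin n → ℂ) i).comp
    (ContinuousLinearMap.snd ℂ _ _))

theorem entryZ_apply (i j : Fin n) (p : Ambient n m) : entryZ i j p = Zc p i j := rfl

theorem entryW_apply (i : Fin m) (j : Fin n) (p : Ambient n m) : entryW i j p = Wc p i j := rfl

theorem ambient_ext {p q : Ambient n m} (hZ : Zc p = Zc q) (hW : Wc p = Wc q) : p = q :=
  Prod.ext (Subtype.ext hZ) hW

theorem Zc_add (p q : Ambient n m) : Zc (p + q) = Zc p + Zc q := rfl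
theorem Wc_add (p q : Ambient n m) : Wc (p + q) = Wc p + Wc q := rfl
theorem Zc_smul (c : ℂ) (p : Ambient n m) : Zc (c • p) = c • Zc p := rfl
theorem Wc_smul (c : ℂ) (p : Ambient n m) : Wc (c • p) = c • Wc p := rfl

theorem del_add (f : Ambient n m → ℂ) (p v w : Ambient n m) :
    del f p (v + w) = del f p v + del f p w := by
  simp only [del, smul_add, map_add]
  ring

theorem delBar_add (f : Ambient n m → ℂ) (p v w : Ambient n m) :
    delBar f p (v + w) = delBar f p v + delBar f p w := by
  simp only [delBar, smul_add, map_add]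
  ring

theorem fderiv_real_smul (f : Ambient n m → ℂ) (p v : Ambient n m) (c : ℂ) :
    fderiv ℝ f p (c • v) = c.re * fderiv ℝ f p v + c.im * fderiv ℝ f p (I • v) := by
  have h : c • v = c.re • v + c.im • (I • v) := by
    apply ambient_ext
    · ext i j
      change c * Zc v i j = (c.re : ℂ) * Zc v i j + c.im * (I * Zc v i j)
      nth_rewrite 1 [← Complex.re_add_im c]
      ring
    · ext i j
      change c * Wc v i j = (c.re : ℂ) * Wc v i j + c.im * (I * Wc v i j)
      nth_rewrite 1 [← Complex.re_add_im c]
      ring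
  rw [h, map_add, map_smul, map_smul, Complex.real_smul, Complex.real_smul]

theorem del_smul (f : Ambient n m → ℂ) (p v : Ambient n m) (c : ℂ) :
    del f p (c • v) = c * del f p v := by
  rw [del, del, smul_smul, fderiv_real_smul f p v c, fderiv_real_smul f p v (I * c)]
  simp only [Complex.mul_re, Complex.mul_im, Complex.I_re, Complex.I_im]
  push_cast
  linear_combination ((1 / 2) * (c.im : ℂ) * fderiv ℝ f p (I • v)) * Complex.I_sq +
    (1 / 2) * (fderiv ℝ f p v - I * fderiv ℝ f p (I • v)) * Complex.re_add_im c

theorem delBar_smul (f : Ambient n m → ℂ) (p v : Ambient n m) (c : ℂ) :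
    delBar f p (c • v) = (starRingEnd ℂ) c * delBar f p v := by
  have hc : (starRingEnd ℂ) c = c.re - c.im * I := by
    apply Complex.ext <;> simp
  rw [delBar, delBar, smul_smul, fderiv_real_smul f p v c, fderiv_real_smul f p v (I * c), hc]
  simp only [Complex.mul_re, Complex.mul_im, Complex.I_re, Complex.I_im]
  push_cast
  linear_combination ((1 / 2) * (c.im : ℂ) * fderiv ℝ f p (I • v)) * Complex.I_sq

/-- The Wirtinger derivative as a complex-linear functional. -/
def delLin (f : Ambient n m → ℂ) (p : Ambient n m) : Ambient n m →ₗ[ℂ] ℂ where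
  toFun := del f p
  map_add' := del_add f p
  map_smul' c v := del_smul f p v c

/-- The conjugate Wirtinger derivative as a conjugate-linear functional. -/
def delBarLin (f : Ambient n m → ℂ) (p : Ambient n m) : Ambient n m →ₛₗ[starRingEnd ℂ] ℂ where
  toFun := delBar f p
  map_add' := delBar_add f p
  map_smul' c v := delBar_smul f p v c

theorem Zc_dirZ (i j : Fin n) : Zc (dirZ i j : Ambient n m) =
    (1 / 2 : ℂ) • (Matrix.single i j 1 + Matrix.single j i 1) := rfl
theorem Wc_dirZ (i j : Fin n) : Wc (dirZ i j : Ambient n m) = 0 := rfl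
theorem Zc_dirW (i : Fin m) (j : Fin n) : Zc (dirW i j : Ambient n m) = 0 := rfl
theorem Wc_dirW (i : Fin m) (j : Fin n) : Wc (dirW i j : Ambient n m) = Matrix.single i j 1 := rfl

theorem Zc_sum {ι : Type*} (s : Finset ι) (F : ι → Ambient n m) :
    Zc (∑ i ∈ s, F i) = ∑ i ∈ s, Zc (F i) := by
  ext a b
  rw [← entryZ_apply, map_sum, Matrix.sum_apply]
  rfl

theorem Wc_sum {ι : Type*} (s : Finset ι) (F : ι → Ambient n m) :
    Wc (∑ i ∈ s, F i) = ∑ i ∈ s, Wc (F i) := by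
  ext a b
  rw [← entryW_apply, map_sum, Matrix.sum_apply]
  rfl

/-- The sum runs over all ordered pairs: the factor `1/2` in `dirZ` compensates for each
off-diagonal entry being met twice. -/
theorem ambient_eq_sum (v : Ambient n m) :
    v = ∑ i, ∑ j, Zc v i j • dirZ i j + ∑ i, ∑ j, Wc v i j • dirW i j := by
  apply ambient_ext
  · simp only [Zc_add, Zc_sum, Zc_smul, Zc_dirZ, Zc_dirW, smul_zero, Finset.sum_const_zero,
      add_zero, smul_add, Finset.sum_add_distrib, Matrix.smul_single, smul_eq_mul,
      mul_one]
    rw [Finset.sum_comm (f := fun i j => Matrix.single j i (Zc v i j * (1 / 2)))]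
    simp only [← Finset.sum_add_distrib, ← Matrix.single_add]
    conv_lhs => rw [Matrix.matrix_eq_sum_single (Zc v)]
    refine Finset.sum_congr rfl fun i _ => Finset.sum_congr rfl fun j _ => ?_
    have : Zc v j i = Zc v i j := congrFun (congrFun (Zc_symm v) i) j
    rw [this]
    congr 1
    ring
  · simp only [Wc_add, Wc_sum, Wc_smul, Wc_dirZ, Wc_dirW, smul_zero, Finset.sum_const_zero,
      zero_add, Matrix.smul_single, smul_eq_mul, mul_one]
    exact Matrix.matrix_eq_sum_single (Wc v)

/-- With the factor `1/2` off the diagonal of `∂f/∂Z`, the differential is a plain trace pairing, so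
the chain rule becomes matrix algebra. -/
theorem del_eq_trace (f : Ambient n m → ℂ) (p v : Ambient n m) :
    del f p v = (dZ f p * Zc v).trace + (dW f p * Wc v).trace := by
  have h : delLin f p v = _ := congrArg (delLin f p) (ambient_eq_sum v)
  rw [map_add, map_sum, map_sum] at h
  simp only [map_sum, map_smul, smul_eq_mul] at h
  change del f p v = _ at h
  rw [h, ← Matrix.trace_transpose (dZ f p * Zc v), Matrix.transpose_mul, Zc_symm,
    Matrix.trace_mul_comm (dW f p)]
  simp only [Matrix.trace, Matrix.diag, Matrix.mul_apply]
  rfl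

theorem delBar_eq_trace (f : Ambient n m → ℂ) (p v : Ambient n m) :
    delBar f p v = (dZbar f p * conjM (Zc v)).trace + (dWbar f p * conjM (Wc v)).trace := by
  have h : delBarLin f p v = _ := congrArg (delBarLin f p) (ambient_eq_sum v)
  rw [map_add, map_sum, map_sum] at h
  simp only [map_sum, LinearMap.map_smulₛₗ, smul_eq_mul] at h
  change delBar f p v = _ at h
  rw [h, ← Matrix.trace_transpose (dZbar f p * conjM (Zc v)), Matrix.transpose_mul,
    ← conjM_transpose, Zc_symm, Matrix.trace_mul_comm (dWbar f p)]
  simp only [Matrix.trace, Matrix.diag, Matrix.mul_apply]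
  rfl

theorem dirZ_comm (i j : Fin n) : (dirZ i j : Ambient n m) = dirZ j i :=
  ambient_ext (by rw [Zc_dirZ, Zc_dirZ, add_comm]) rfl

theorem dZ_symm (f : Ambient n m → ℂ) (p : Ambient n m) : (dZ f p)ᵀ = dZ f p := by
  ext i j
  exact congrArg (del f p) (dirZ_comm j i)

theorem dZbar_symm (f : Ambient n m → ℂ) (p : Ambient n m) : (dZbar f p)ᵀ = dZbar f p := by
  ext i j
  exact congrArg (delBar f p) (dirZ_comm j i)

/-- The differential of a holomorphic map commutes with `I`, so the two types of Wirtinger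
derivative do not mix. -/
theorem del_comp {f : Ambient n m → ℂ} {φ : Ambient n m → Ambient n m} {p : Ambient n m}
    (hφ : DifferentiableAt ℂ φ p) (hf : DifferentiableAt ℝ f (φ p)) (v : Ambient n m) :
    del (fun q => f (φ q)) p v = del f (φ p) (fderiv ℂ φ p v) := by
  have h := hf.hasFDerivAt.comp p (hφ.hasFDerivAt.restrictScalars ℝ)
  have h' : fderiv ℝ (fun q => f (φ q)) p = _ := h.fderiv
  simp only [del, h', ContinuousLinearMap.comp_apply, ContinuousLinearMap.coe_restrictScalars',
    map_smul]

theorem delBar_comp {f : Ambient n m → ℂ} {φ : Ambient n m → Ambient n m} {p : Ambient n m}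
    (hφ : DifferentiableAt ℂ φ p) (hf : DifferentiableAt ℝ f (φ p)) (v : Ambient n m) :
    delBar (fun q => f (φ q)) p v = delBar f (φ p) (fderiv ℂ φ p v) := by
  have h := hf.hasFDerivAt.comp p (hφ.hasFDerivAt.restrictScalars ℝ)
  have h' : fderiv ℝ (fun q => f (φ q)) p = _ := h.fderiv
  simp only [delBar, h', ContinuousLinearMap.comp_apply, ContinuousLinearMap.coe_restrictScalars',
    map_smul]

theorem del_of_differentiableAt {h : Ambient n m → ℂ} {p : Ambient n m}
    (hh : DifferentiableAt ℂ h p) (v : Ambient n m) : del h p v = fderiv ℂ h p v := by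
  have h' : fderiv ℝ h p = _ := (hh.hasFDerivAt.restrictScalars ℝ).fderiv
  simp only [del, h', ContinuousLinearMap.coe_restrictScalars', map_smul, smul_eq_mul]
  linear_combination (-(1 / 2) * fderiv ℂ h p v) * Complex.I_sq

theorem delBar_of_differentiableAt {h : Ambient n m → ℂ} {p : Ambient n m}
    (hh : DifferentiableAt ℂ h p) (v : Ambient n m) : delBar h p v = 0 := by
  have h' : fderiv ℝ h p = _ := (hh.hasFDerivAt.restrictScalars ℝ).fderiv
  simp only [delBar, h', ContinuousLinearMap.coe_restrictScalars', map_smul, smul_eq_mul]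
  linear_combination ((1 / 2) * fderiv ℂ h p v) * Complex.I_sq

theorem del_mul {f h : Ambient n m → ℂ} {p : Ambient n m} (hf : DifferentiableAt ℝ f p)
    (hh : DifferentiableAt ℝ h p) (v : Ambient n m) :
    del (fun q => f q * h q) p v = f p * del h p v + h p * del f p v := by
  simp only [del, fderiv_fun_mul hf hh, add_apply,
    smul_apply, smul_eq_mul]
  ring

theorem delBar_mul {f h : Ambient n m → ℂ} {p : Ambient n m} (hf : DifferentiableAt ℝ f p)
    (hh : DifferentiableAt ℝ h p) (v : Ambient n m) :
    delBar (fun q => f q * h q) p v = f p * delBar h p v + h p * delBar f p v := by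
  simp only [delBar, fderiv_fun_mul hf hh, add_apply,
    smul_apply, smul_eq_mul]
  ring

theorem del_fun_sum {ι : Type*} (s : Finset ι) {F : ι → Ambient n m → ℂ} {p : Ambient n m}
    (hF : ∀ i ∈ s, DifferentiableAt ℝ (F i) p) (v : Ambient n m) :
    del (fun q => ∑ i ∈ s, F i q) p v = ∑ i ∈ s, del (F i) p v := by
  simp only [del, fderiv_fun_sum hF, sum_apply, Finset.mul_sum,
    ← Finset.sum_sub_distrib]

theorem del_congr {f h : Ambient n m → ℂ} {p : Ambient n m} (e : f =ᶠ[𝓝 p] h) (v : Ambient n m) :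
    del f p v = del h p v := by
  simp only [del, e.fderiv_eq]

theorem delBar_congr {f h : Ambient n m → ℂ} {p : Ambient n m} (e : f =ᶠ[𝓝 p] h)
    (v : Ambient n m) : delBar f p v = delBar h p v := by
  simp only [delBar, e.fderiv_eq]

end Wirtinger

/-! ### Derivatives of the action and of the automorphy factor -/

section ActDerivative

variable {n m : ℕ}

theorem continuous_im_Zc (i j : Fin n) : Continuous fun p : Ambient n m => (Zc p i j).im :=
  Complex.continuous_im.comp (entryZ i j).continuous

/-- Positivity of the form on the compact unit sphere persists for nearby `Z`, and homogeneity
extends it to all nonzero vectors. -/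
theorem isOpen_space : IsOpen (space n m) := by
  have hsymm : ∀ p : Ambient n m, ((Zc p).map Complex.im).IsHermitian := fun p => by
    ext i j
    exact congrArg Complex.im (congrFun (congrFun (Zc_symm p) i) j)
  rw [isOpen_iff_mem_nhds]
  intro p hp
  have hK := isCompact_sphere (0 : Fin n → ℝ) 1
  have hcont : Continuous fun z : Ambient n m × (Fin n → ℝ) =>
      z.2 ⬝ᵥ (Zc z.1).map Complex.im *ᵥ z.2 := by
    simp only [dotProduct, Matrix.mulVec, Matrix.map_apply]
    refine continuous_finsetSum _ fun i _ => Continuous.mul (by fun_prop)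
      (continuous_finsetSum _ fun j _ => Continuous.mul ?_ (by fun_prop))
    exact (continuous_im_Zc i j).comp continuous_fst
  have h := hK.eventually_forall_of_forall_eventually (x₀ := p)
    (P := fun q x => 0 < x ⬝ᵥ (Zc q).map Complex.im *ᵥ x) (fun x hx => by
      refine hcont.continuousAt.eventually_const_lt ?_
      have hx0 : x ≠ 0 := by
        rintro rfl
        simp at hx
      simpa using Matrix.PosDef.dotProduct_mulVec_pos hp hx0)
  filter_upwards [h] with q hq
  refine Matrix.PosDef.of_dotProduct_mulVec_pos (hsymm q) fun x hx => ?_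
  have hx' : 0 < ‖x‖ := norm_pos_iff.mpr hx
  have h1 := hq (‖x‖⁻¹ • x) (by
    rw [mem_sphere_zero_iff_norm, norm_smul, norm_inv, norm_norm, inv_mul_cancel₀ hx'.ne'])
  rw [Matrix.mulVec_smul, smul_dotProduct, dotProduct_smul, smul_eq_mul, smul_eq_mul] at h1
  rw [star_trivial]
  have h2 : 0 < ‖x‖⁻¹ := inv_pos.mpr hx'
  exact pos_of_mul_pos_right (pos_of_mul_pos_right h1 h2.le) h2.le

theorem smoothAt_Zc (p : Ambient n m) : SmoothAt ℂ Zc p :=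
  fun i j => (entryZ i j).contDiff.contDiffAt

theorem smoothAt_Wc (p : Ambient n m) : SmoothAt ℂ Wc p :=
  fun i j => (entryW i j).contDiff.contDiffAt

theorem smoothAt_den (g : JacobiGroup n m) (p : Ambient n m) : SmoothAt ℂ (den g) p :=
  ((SmoothAt.const _ _).mul (smoothAt_Zc p)).add (SmoothAt.const _ _)

theorem smoothAt_num (g : JacobiGroup n m) (p : Ambient n m) : SmoothAt ℂ (num g) p :=
  ((SmoothAt.const _ _).mul (smoothAt_Zc p)).add (SmoothAt.const _ _)

theorem smoothAt_shiftW (g : JacobiGroup n m) (p : Ambient n m) : SmoothAt ℂ (shiftW g) p :=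
  ((smoothAt_Wc p).add ((SmoothAt.const _ _).mul (smoothAt_Zc p))).add (SmoothAt.const _ _)

theorem smoothAt_den_inv (g : JacobiGroup n m) {p : Ambient n m} (hp : p ∈ space n m) :
    SmoothAt ℂ (fun q => (den g q)⁻¹) p :=
  (smoothAt_den g p).inv (isUnit_det_den g hp)

theorem smoothAt_slope (g : JacobiGroup n m) {p : Ambient n m} (hp : p ∈ space n m) :
    SmoothAt ℂ (slope g) p :=
  (smoothAt_den_inv g hp).mul (SmoothAt.const _ _)

theorem smoothAt_offset (g : JacobiGroup n m) {p : Ambient n m} (hp : p ∈ space n m) :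
    SmoothAt ℂ (offset g) p :=
  (SmoothAt.const _ _).sub ((smoothAt_shiftW g p).mul (smoothAt_slope g hp))

/-- The symmetric part of a matrix, as a linear map onto the space of symmetric matrices. -/
def symmPart (n : ℕ) : (Fin n → Fin n → ℂ) →ₗ[ℂ] SymMat n where
  toFun Z := ⟨fun i j => (1 / 2) * (Z i j + Z j i), by
    ext i j
    simp only [Matrix.transpose_apply, Matrix.of_apply]
    ring⟩
  map_add' Z Z' := by
    ext i j
    simp only [Pi.add_apply, Submodule.coe_add]
    ring
  map_smul' c Z := by
    ext i j
    simp only [Pi.smul_apply, smul_eq_mul, RingHom.id_apply, Submodule.coe_smul]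
    ring

/-- Symmetrizing changes nothing here, but presents the `Z` component as a linear map applied to a
function with values in all matrices, whose smoothness is checked entrywise. -/
theorem act_eq_symmPart (g : JacobiGroup n m) (q : Ambient n m) :
    act g q = (symmPart n (Matrix.of.symm (num g q * (den g q)⁻¹)),
      Matrix.of.symm (shiftW g q * (den g q)⁻¹)) := by
  refine Prod.ext (Subtype.ext ?_) rfl
  ext i j
  have h : (num g q * (den g q)⁻¹) j i = (num g q * (den g q)⁻¹) i j :=
    congrFun (congrFun (isSymm_frac g q) i) j
  change (num g q * (den g q)⁻¹) i j = (1 / 2) *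
    ((num g q * (den g q)⁻¹) i j + (num g q * (den g q)⁻¹) j i)
  rw [h]
  ring

theorem differentiableAt_act (g : JacobiGroup n m) {p : Ambient n m} (hp : p ∈ space n m) :
    DifferentiableAt ℂ (act g) p := by
  have h1 : ContDiffAt ℂ ∞ (fun q => (Matrix.of.symm (num g q * (den g q)⁻¹) :
      Fin n → Fin n → ℂ)) p :=
    contDiffAt_pi.mpr fun i => contDiffAt_pi.mpr fun j =>
      ((smoothAt_num g p).mul (smoothAt_den_inv g hp)) i j
  have h2 : ContDiffAt ℂ ∞ (fun q => (Matrix.of.symm (shiftW g q * (den g q)⁻¹) :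
      Fin m → Fin n → ℂ)) p :=
    contDiffAt_pi.mpr fun i => contDiffAt_pi.mpr fun j =>
      ((smoothAt_shiftW g p).mul (smoothAt_den_inv g hp)) i j
  have h3 : act g = fun q => ((symmPart n).toContinuousLinearMap
      (Matrix.of.symm (num g q * (den g q)⁻¹)), Matrix.of.symm (shiftW g q * (den g q)⁻¹)) :=
    funext (act_eq_symmPart g)
  rw [h3]
  exact ((((symmPart n).toContinuousLinearMap.contDiff.contDiffAt).comp p h1).prodMk
    h2).differentiableAt (by simp)

variable {p v : Ambient n m}

theorem hasMatDeriv_Zc : HasMatDeriv Zc (Zc v) p v := fun i j =>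
  (entryZ (m := m) i j).hasFDerivAt.hasLineDerivAt v

theorem hasMatDeriv_Wc : HasMatDeriv Wc (Wc v) p v := fun i j =>
  (entryW (n := n) i j).hasFDerivAt.hasLineDerivAt v

theorem hasMatDeriv_den (g : JacobiGroup n m) :
    HasMatDeriv (den g) (toC g.sp.1.toBlocks₂₁ * Zc v) p v :=
  HasMatDeriv.congr_deriv (F := den g) (((HasMatDeriv.const (toC g.sp.1.toBlocks₂₁)).mul
    (hasMatDeriv_Zc (p := p) (v := v))).add (HasMatDeriv.const (toC g.sp.1.toBlocks₂₂))) (by simp)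

theorem hasMatDeriv_num (g : JacobiGroup n m) :
    HasMatDeriv (num g) (toC g.sp.1.toBlocks₁₁ * Zc v) p v :=
  HasMatDeriv.congr_deriv (F := num g) (((HasMatDeriv.const (toC g.sp.1.toBlocks₁₁)).mul
    (hasMatDeriv_Zc (p := p) (v := v))).add (HasMatDeriv.const (toC g.sp.1.toBlocks₁₂))) (by simp)

theorem hasMatDeriv_shiftW (g : JacobiGroup n m) :
    HasMatDeriv (shiftW g) (Wc v + toC g.lam * Zc v) p v :=
  HasMatDeriv.congr_deriv (F := shiftW g) (((hasMatDeriv_Wc (p := p) (v := v)).add ((HasMatDeriv.const (toC g.lam)).mul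
    (hasMatDeriv_Zc (p := p) (v := v)))).add (HasMatDeriv.const (toC g.mu))) (by simp)

theorem hasMatDeriv_den_inv (g : JacobiGroup n m) (hp : p ∈ space n m) :
    HasMatDeriv (fun q => (den g q)⁻¹) (-(slope g p * Zc v * (den g p)⁻¹)) p v := by
  have h := (hasMatDeriv_den (v := v) g).inv (smoothAt_den g p) (isUnit_det_den g hp)
  rwa [← Matrix.mul_assoc] at h

theorem hasMatDeriv_slope (g : JacobiGroup n m) (hp : p ∈ space n m) :
    HasMatDeriv (slope g) (-(slope g p * Zc v * slope g p)) p v := by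
  have h := (hasMatDeriv_den_inv (v := v) g hp).mul
    (HasMatDeriv.const (toC g.sp.1.toBlocks₂₁))
  rwa [Matrix.mul_zero, add_zero, Matrix.neg_mul, Matrix.mul_assoc] at h

theorem hasMatDeriv_offset_of_Zc_eq_zero (g : JacobiGroup n m) (hp : p ∈ space n m)
    (hv : Zc v = 0) : HasMatDeriv (offset g) (-(Wc v * slope g p)) p v := by
  have h := (HasMatDeriv.const (toC g.lam)).sub
    ((hasMatDeriv_shiftW (v := v) g).mul (hasMatDeriv_slope (v := v) g hp))
  exact HasMatDeriv.congr_deriv (F := offset g) h (by simp [hv])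

theorem hasMatDeriv_comp_fderiv (g : JacobiGroup n m) (hp : p ∈ space n m) :
    HasMatDeriv (fun q => Zc (act g q)) (Zc (fderiv ℂ (act g) p v)) p v ∧
    HasMatDeriv (fun q => Wc (act g q)) (Wc (fderiv ℂ (act g) p v)) p v :=
  ⟨fun i j => ((entryZ (m := m) i j).hasFDerivAt.comp p
    (differentiableAt_act g hp).hasFDerivAt).hasLineDerivAt v,
  fun i j => ((entryW (n := n) i j).hasFDerivAt.comp p
    (differentiableAt_act g hp).hasFDerivAt).hasLineDerivAt v⟩

theorem Wc_fderiv_act (g : JacobiGroup n m) (hp : p ∈ space n m) (v : Ambient n m) :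
    Wc (fderiv ℂ (act g) p v) = (Wc v + offset g p * Zc v) * (den g p)⁻¹ := by
  refine (hasMatDeriv_comp_fderiv g hp).2.unique ?_
  have h := (hasMatDeriv_shiftW (v := v) g).mul (hasMatDeriv_den_inv (v := v) g hp)
  refine HasMatDeriv.congr_deriv (F := fun q => Wc (act g q)) h ?_
  simp only [offset, Matrix.add_mul, Matrix.sub_mul, Matrix.mul_neg, Matrix.mul_assoc]
  abel

/-- Differentiating `Z' = (AZ + B)d⁻¹` gives `(A - Z'C)Ud⁻¹`. As `Z'` is symmetric, `A - Z'C =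
d⁻ᵗ(dᵗA - (AZ + B)ᵗC)`, and the bracket is `1` by the symplectic relations. -/
theorem Zc_fderiv_act (g : JacobiGroup n m) (hp : p ∈ space n m) (v : Ambient n m) :
    Zc (fderiv ℂ (act g) p v) = ((den g p)⁻¹)ᵀ * Zc v * (den g p)⁻¹ := by
  refine (hasMatDeriv_comp_fderiv g hp).1.unique ?_
  have h := (hasMatDeriv_num (v := v) g).mul (hasMatDeriv_den_inv (v := v) g hp)
  refine HasMatDeriv.congr_deriv (F := fun q => Zc (act g q)) h ?_
  have hd := isUnit_det_den g hp
  have hdt : IsUnit ((den g p)ᵀ).det := by rwa [Matrix.det_transpose]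
  obtain ⟨h1, h2, h3, h4, -⟩ := complex_block_relations g
  have key : (den g p)ᵀ * toC g.sp.1.toBlocks₁₁ - (num g p)ᵀ * toC g.sp.1.toBlocks₂₁ = 1 := by
    simp only [num, den, Matrix.transpose_add, Matrix.transpose_mul, Zc_symm, Matrix.add_mul,
      Matrix.mul_assoc, h1, h4]
    abel
  have hsym : ((den g p)⁻¹)ᵀ * (num g p)ᵀ = num g p * (den g p)⁻¹ := by
    rw [← Matrix.transpose_mul]
    exact isSymm_frac g p
  have h5 : ((den g p)⁻¹)ᵀ = toC g.sp.1.toBlocks₁₁ - num g p * slope g p := by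
    rw [slope, ← Matrix.mul_assoc, ← hsym, Matrix.mul_assoc, ← sub_eq_iff_eq_add'.mpr
      (sub_eq_iff_eq_add.mp key), Matrix.transpose_nonsing_inv]
    rw [Matrix.mul_sub, ← Matrix.mul_assoc, Matrix.nonsing_inv_mul _ hdt, Matrix.one_mul,
      Matrix.mul_one]
    abel
  rw [h5]
  simp only [Matrix.sub_mul, Matrix.mul_neg, Matrix.mul_assoc]
  abel

/-- The exponent of the automorphy factor. -/
def expo (M : Matrix (Fin m) (Fin m) ℝ) (g : JacobiGroup n m) (p : Ambient n m) : ℂ :=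
  2 * Real.pi * I *
    (toC M * (shiftW g p * (den g p)⁻¹ * toC g.sp.1.toBlocks₂₁ * (shiftW g p)ᵀ) -
      toC M * (toC g.lam * Zc p * (toC g.lam)ᵀ + (2 : ℂ) • (toC g.lam * (Wc p)ᵀ) +
        toC g.kappa + toC g.mu * (toC g.lam)ᵀ)).trace

theorem autFactor_eq (k : ℤ) (M : Matrix (Fin m) (Fin m) ℝ) (g : JacobiGroup n m)
    (p : Ambient n m) : autFactor k M g p = (den g p).det ^ k * Complex.exp (expo M g p) := rfl

theorem contDiffAt_expo (M : Matrix (Fin m) (Fin m) ℝ) (g : JacobiGroup n m)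
    (hp : p ∈ space n m) : ContDiffAt ℂ ∞ (expo M g) p := by
  have hS := smoothAt_shiftW g p
  have hZ := smoothAt_Zc p
  have hW := smoothAt_Wc p
  have hd := smoothAt_den_inv g hp
  refine contDiffAt_const.mul (SmoothAt.trace ?_)
  exact ((SmoothAt.const _ _).mul (((hS.mul hd).mul (SmoothAt.const _ _)).mul hS.transpose)).sub
    ((SmoothAt.const _ _).mul (((((SmoothAt.const _ _).mul hZ).mul (SmoothAt.const _ _)).add
      (SmoothAt.smul contDiffAt_const ((SmoothAt.const _ _).mul hW.transpose))).add
        (SmoothAt.const _ _) |>.add (SmoothAt.const _ _)))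

theorem contDiffAt_autFactor (k : ℤ) (M : Matrix (Fin m) (Fin m) ℝ) (g : JacobiGroup n m)
    (hp : p ∈ space n m) : ContDiffAt ℂ ∞ (autFactor k M g) p := by
  have hd := (isUnit_det_den g hp).ne_zero
  refine ContDiffAt.mul ?_ (contDiffAt_expo M g hp).cexp
  have hdet := (smoothAt_den g p).det
  cases k with
  | ofNat k => simpa using hdet.pow k
  | negSucc k =>
    simp only [zpow_negSucc]
    exact (hdet.pow (k + 1)).inv (pow_ne_zero _ hd)

/-- Because `den` is affine in `Z`, it equals `d(1 + tNU)` exactly along the line. -/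
theorem hasLineDerivAt_det_den (g : JacobiGroup n m) (hp : p ∈ space n m) (v : Ambient n m) :
    HasLineDerivAt ℂ (fun q => (den g q).det) ((den g p).det * (slope g p * Zc v).trace) p v := by
  have hd := isUnit_det_den g hp
  have h := (hasDerivAt_det_one_add_smul (slope g p * Zc v)).const_mul (den g p).det
  refine HasDerivAt.congr_of_eventuallyEq h (Eventually.of_forall fun t => ?_)
  change (den g (p + t • v)).det = (den g p).det * (1 + t • (slope g p * Zc v)).det
  rw [← Matrix.det_mul, Matrix.mul_add, Matrix.mul_one, Matrix.mul_smul, ← Matrix.mul_assoc,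
    slope, ← Matrix.mul_assoc, Matrix.mul_nonsing_inv _ hd, Matrix.one_mul, den, den, Zc_add,
    Zc_smul, Matrix.mul_add, Matrix.mul_smul]
  congr 1
  abel

/-- Completing the square. Here `S` stands for `W + λZ + μ`, `L` for `λ` and `N` for `slope`; `X +
LU` is the derivative of `S` and `-NUN` that of `N`. The derivative of the exponent then depends on
`S`, `L`, `N` only through `L - SN`, which is `offset`. -/
theorem expo_trace_identity {M : Matrix (Fin m) (Fin m) ℂ} {S L X : Matrix (Fin m) (Fin n) ℂ}
    {N U : Matrix (Fin n) (Fin n) ℂ} (hM : Mᵀ = M) (hN : Nᵀ = N) (hU : Uᵀ = U) :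
    (M * ((X + L * U) * N * Sᵀ - S * N * U * N * Sᵀ + S * N * (X + L * U)ᵀ) -
      M * (L * U * Lᵀ + (2 : ℂ) • (L * Xᵀ))).trace =
    -((L - S * N)ᵀ * M * (L - S * N) * U).trace - 2 * ((L - S * N)ᵀ * M * X).trace := by
  have h1 : (M * (X * (N * Sᵀ))).trace = (N * (Sᵀ * (M * X))).trace := by
    rw [← Matrix.mul_assoc, Matrix.trace_mul_comm, Matrix.mul_assoc]
  have h2 : (M * (L * (U * (N * Sᵀ)))).trace = (N * (Sᵀ * (M * (L * U)))).trace := by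
    rw [← Matrix.mul_assoc L, ← Matrix.mul_assoc, Matrix.trace_mul_comm, Matrix.mul_assoc]
  have h3 : (M * (S * (N * (U * (N * Sᵀ))))).trace =
      (N * (Sᵀ * (M * (S * (N * U))))).trace := by
    rw [← Matrix.mul_assoc N U, ← Matrix.mul_assoc S, ← Matrix.mul_assoc,
      Matrix.trace_mul_comm, Matrix.mul_assoc]
  have h4 : (M * (S * (N * Xᵀ))).trace = (N * (Sᵀ * (M * X))).trace := by
    rw [← h1, ← Matrix.trace_transpose]
    simp only [Matrix.transpose_mul, Matrix.transpose_transpose, hM, hN]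
    rw [Matrix.trace_mul_comm]
    simp only [Matrix.mul_assoc]
  have h5 : (M * (S * (N * (U * Lᵀ)))).trace = (Lᵀ * (M * (S * (N * U)))).trace := by
    rw [← Matrix.mul_assoc N, ← Matrix.mul_assoc S, ← Matrix.mul_assoc M, Matrix.trace_mul_comm]
  have h6 : (M * (L * (U * Lᵀ))).trace = (Lᵀ * (M * (L * U))).trace := by
    rw [← Matrix.mul_assoc L, ← Matrix.mul_assoc M, Matrix.trace_mul_comm]
  have h7 : (M * (L * Xᵀ)).trace = (Lᵀ * (M * X)).trace := by
    rw [← Matrix.trace_transpose]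
    simp only [Matrix.transpose_mul, Matrix.transpose_transpose, hM]
    rw [Matrix.mul_assoc, Matrix.trace_mul_comm, Matrix.mul_assoc]
  simp only [Matrix.transpose_add, Matrix.transpose_sub, Matrix.transpose_mul, hN, hU,
    Matrix.mul_add, Matrix.add_mul, Matrix.mul_sub, Matrix.sub_mul, Matrix.trace_add,
    Matrix.trace_sub, Matrix.mul_smul, Matrix.trace_smul, Matrix.mul_assoc, h1, h2, h3, h4, h5,
    h6, h7, smul_eq_mul]
  ring

theorem hasLineDerivAt_expo {M : Matrix (Fin m) (Fin m) ℝ} (hM : M.IsSymm) (g : JacobiGroup n m)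
    (hp : p ∈ space n m) (v : Ambient n m) :
    HasLineDerivAt ℂ (expo M g)
      (2 * Real.pi * I * (-((offset g p)ᵀ * toC M * offset g p * Zc v).trace -
        2 * ((offset g p)ᵀ * toC M * Wc v).trace)) p v := by
  have hM' : (toC M)ᵀ = toC M := congrArg toC hM
  have hS := hasMatDeriv_shiftW (p := p) (v := v) g
  have hd := hasMatDeriv_den_inv (v := v) g hp
  have hZ := hasMatDeriv_Zc (p := p) (v := v)
  have hW := hasMatDeriv_Wc (p := p) (v := v)
  have h := ((((HasMatDeriv.const (toC M)).mul (((hS.mul hd).mul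
    (HasMatDeriv.const (toC g.sp.1.toBlocks₂₁))).mul hS.transpose)).sub
    ((HasMatDeriv.const (toC M)).mul (((((HasMatDeriv.const (toC g.lam)).mul hZ).mul
      (HasMatDeriv.const (toC g.lam)ᵀ)).add
      (((HasMatDeriv.const (toC g.lam)).mul hW.transpose).const_smul 2)).add
        (HasMatDeriv.const (toC g.kappa)) |>.add
          (HasMatDeriv.const (toC g.mu * (toC g.lam)ᵀ))))).trace)
  have h' := HasDerivAt.const_mul (2 * Real.pi * I) h
  rw [offset, ← expo_trace_identity hM' (slope_symm g hp) (Zc_symm v)]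
  refine HasDerivAt.congr_deriv (f := fun t : ℂ => expo M g (p + t • v)) h' ?_
  refine congrArg (fun X : Matrix (Fin m) (Fin m) ℂ => 2 * Real.pi * I * X.trace) ?_
  simp only [slope, Matrix.zero_mul, Matrix.mul_zero, zero_add, add_zero, Matrix.mul_neg,
    Matrix.neg_mul, Matrix.mul_assoc, Matrix.add_mul, Matrix.mul_add, sub_eq_add_neg]

theorem fderiv_autFactor (k : ℤ) {M : Matrix (Fin m) (Fin m) ℝ} (hM : M.IsSymm)
    (g : JacobiGroup n m) (hp : p ∈ space n m) (v : Ambient n m) :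
    fderiv ℂ (autFactor k M g) p v = autFactor k M g p *
      (k * (slope g p * Zc v).trace +
        2 * Real.pi * I * (-((offset g p)ᵀ * toC M * offset g p * Zc v).trace -
        2 * ((offset g p)ᵀ * toC M * Wc v).trace)) := by
  have hd := (isUnit_det_den g hp).ne_zero
  have h1 := ((contDiffAt_autFactor k M g hp).differentiableAt
    (by simp)).hasFDerivAt.hasLineDerivAt v
  refine h1.unique ?_
  have h2 : HasDerivAt (fun t : ℂ => (den g (p + t • v)).det ^ k)
      (k * (den g p).det ^ (k - 1) * ((den g p).det * (slope g p * Zc v).trace)) 0 := by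
    have h3 := hasDerivAt_zpow k (den g (p + (0 : ℂ) • v)).det (Or.inl (by simpa using hd))
    have h4 := HasDerivAt.comp (0 : ℂ) h3 (hasLineDerivAt_det_den g hp v)
    simpa [Function.comp_def] using h4
  have h5 := HasDerivAt.mul h2 (HasDerivAt.cexp (hasLineDerivAt_expo hM g hp v))
  refine HasDerivAt.congr_deriv (f := fun t : ℂ => autFactor k M g (p + t • v)) h5 ?_
  simp only [zero_smul, add_zero, autFactor_eq]
  rw [zpow_sub_one₀ hd]
  field_simp

end ActDerivative

/-! ### Transformation laws of the first derivatives -/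

section FirstOrder

variable {n m : ℕ}

/-- Symmetric test matrices detect exactly the symmetric part. -/
theorem add_transpose_eq_of_trace_eq {P Q : Matrix (Fin n) (Fin n) ℂ}
    (h : ∀ U : Matrix (Fin n) (Fin n) ℂ, Uᵀ = U → (P * U).trace = (Q * U).trace) :
    P + Pᵀ = Q + Qᵀ := by
  have key : ∀ A X : Matrix (Fin n) (Fin n) ℂ,
      ((A + Aᵀ) * X).trace = (A * (X + Xᵀ)).trace := fun A X => by
    rw [Matrix.add_mul, Matrix.mul_add, Matrix.trace_add, Matrix.trace_add,
      ← Matrix.trace_transpose (Aᵀ * X), Matrix.transpose_mul, Matrix.transpose_transpose,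
      Matrix.trace_mul_comm Xᵀ]
  rw [Matrix.ext_iff_trace_mul_right]
  intro X
  rw [key, key]
  refine h _ ?_
  rw [Matrix.transpose_add, Matrix.transpose_transpose, add_comm]

/-- Solving the chain rule for the gradients in the new coordinates. -/
theorem gradient_solve {d GZ KZ : Matrix (Fin n) (Fin n) ℂ} {R : Matrix (Fin m) (Fin n) ℂ}
    {GW KW : Matrix (Fin n) (Fin m) ℂ} (hd : IsUnit d.det) (hGZ : GZᵀ = GZ) (hKZ : KZᵀ = KZ)
    (h : ∀ (U : Matrix (Fin n) (Fin n) ℂ) (X : Matrix (Fin m) (Fin n) ℂ), Uᵀ = U →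
      (GZ * ((d⁻¹)ᵀ * U * d⁻¹)).trace + (GW * ((X + R * U) * d⁻¹)).trace =
        (KZ * U).trace + (KW * X).trace) :
    GW = d * KW ∧
    GZ = d * (KZ - (1 / 2 : ℂ) • (KW * R + Rᵀ * KWᵀ)) * dᵀ := by
  have hdt : IsUnit (dᵀ).det := by rwa [Matrix.det_transpose]
  -- Directions with `U = 0` determine `GW`.
  have hW : d⁻¹ * GW = KW := by
    rw [Matrix.ext_iff_trace_mul_right]
    intro X
    have := h 0 X Matrix.transpose_zero
    simp only [Matrix.mul_zero, Matrix.zero_mul, Matrix.trace_zero, zero_add, add_zero] at this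
    rw [← this, ← Matrix.mul_assoc GW, Matrix.trace_mul_comm _ d⁻¹, Matrix.mul_assoc]
  -- Directions with `X = 0` then determine `GZ`, whose symmetry makes symmetric `U` sufficient.
  have hZ : ∀ U : Matrix (Fin n) (Fin n) ℂ, Uᵀ = U →
      ((d⁻¹ * GZ * (d⁻¹)ᵀ + KW * R) * U).trace = (KZ * U).trace := fun U hU => by
    have := h U 0 hU
    simp only [Matrix.mul_zero, Matrix.trace_zero, zero_add, add_zero] at this
    rw [← this, ← hW, Matrix.add_mul, Matrix.trace_add, ← Matrix.mul_assoc GZ,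
      Matrix.trace_mul_comm _ d⁻¹, ← Matrix.mul_assoc GW, Matrix.trace_mul_comm _ d⁻¹]
    simp only [Matrix.mul_assoc]
  have hZ' := add_transpose_eq_of_trace_eq hZ
  refine ⟨by rw [← hW, ← Matrix.mul_assoc, Matrix.mul_nonsing_inv _ hd, Matrix.one_mul], ?_⟩
  have hG : d⁻¹ * GZ * (d⁻¹)ᵀ = KZ - (1 / 2 : ℂ) • (KW * R + Rᵀ * KWᵀ) := by
    simp only [Matrix.transpose_add, Matrix.transpose_mul, Matrix.transpose_transpose, hGZ, hKZ,
      ← Matrix.mul_assoc] at hZ'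
    have h2 : (2 : ℂ) • (d⁻¹ * GZ * (d⁻¹)ᵀ) = (2 : ℂ) • KZ - (KW * R + Rᵀ * KWᵀ) := by
      rw [two_smul, two_smul, ← hZ']
      abel
    have h3 := congrArg (fun A => (1 / 2 : ℂ) • A) h2
    simp only [smul_sub, smul_smul] at h3
    norm_num at h3
    rw [h3]
    norm_num
  rw [← hG, Matrix.transpose_nonsing_inv]
  simp only [Matrix.mul_assoc]
  rw [Matrix.nonsing_inv_mul _ hdt, Matrix.mul_one, ← Matrix.mul_assoc,
    Matrix.mul_nonsing_inv _ hd, Matrix.one_mul]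

/-- The point `(U, X)`. -/
def pair (U : Matrix (Fin n) (Fin n) ℂ) (X : Matrix (Fin m) (Fin n) ℂ) (hU : Uᵀ = U) :
    Ambient n m :=
  (⟨Matrix.of.symm U, hU⟩, Matrix.of.symm X)

theorem Zc_pair {U : Matrix (Fin n) (Fin n) ℂ} {X : Matrix (Fin m) (Fin n) ℂ} (hU : Uᵀ = U) :
    Zc (pair U X hU) = U := rfl

theorem Wc_pair {U : Matrix (Fin n) (Fin n) ℂ} {X : Matrix (Fin m) (Fin n) ℂ} (hU : Uᵀ = U) :
    Wc (pair U X hU) = X := rfl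

theorem space_mem_nhds {p : Ambient n m} (hp : p ∈ space n m) : space n m ∈ 𝓝 p :=
  isOpen_space.mem_nhds hp

variable {f : Ambient n m → ℂ} {k : ℤ} {M : Matrix (Fin m) (Fin m) ℝ} {g : JacobiGroup n m}
  {p : Ambient n m}

theorem differentiableAt_of_mem (hs : ContDiffOn ℝ ∞ f (space n m)) (hp : p ∈ space n m) :
    DifferentiableAt ℝ f p :=
  (hs.contDiffAt (space_mem_nhds hp)).differentiableAt (by simp)

theorem differentiableAt_autFactor (k : ℤ) (M : Matrix (Fin m) (Fin m) ℝ) (g : JacobiGroup n m)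
    (hp : p ∈ space n m) : DifferentiableAt ℂ (autFactor k M g) p :=
  (contDiffAt_autFactor k M g hp).differentiableAt (by simp)

theorem del_act (hs : ContDiffOn ℝ ∞ f (space n m)) (hp : p ∈ space n m)
    (ht : ∀ q ∈ space n m, f (act g q) = autFactor k M g q * f q) (v : Ambient n m) :
    del f (act g p) (fderiv ℂ (act g) p v) =
      autFactor k M g p * del f p v + f p * fderiv ℂ (autFactor k M g) p v := by
  have hJ := differentiableAt_autFactor k M g hp
  rw [← del_comp (differentiableAt_act g hp) (differentiableAt_of_mem hs (act_mem_space g hp)),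
    del_congr (h := fun q => autFactor k M g q * f q)
      (by filter_upwards [space_mem_nhds hp] with q hq using ht q hq),
    del_mul (hJ.restrictScalars ℝ) (differentiableAt_of_mem hs hp),
    del_of_differentiableAt hJ]

theorem delBar_act (hs : ContDiffOn ℝ ∞ f (space n m)) (hp : p ∈ space n m)
    (ht : ∀ q ∈ space n m, f (act g q) = autFactor k M g q * f q) (v : Ambient n m) :
    delBar f (act g p) (fderiv ℂ (act g) p v) = autFactor k M g p * delBar f p v := by
  have hJ := differentiableAt_autFactor k M g hp
  rw [← delBar_comp (differentiableAt_act g hp) (differentiableAt_of_mem hs (act_mem_space g hp)),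
    delBar_congr (h := fun q => autFactor k M g q * f q)
      (by filter_upwards [space_mem_nhds hp] with q hq using ht q hq),
    delBar_mul (hJ.restrictScalars ℝ) (differentiableAt_of_mem hs hp),
    delBar_of_differentiableAt hJ, mul_zero, add_zero]

/-- The chain rule of `del_act`, solved by `gradient_solve`. The sign of the `RᵗMR` term is reversed
on the way: the logarithmic derivative gives `-2πi`, and the term `-4πi RᵗM` of the `W` gradient,
multiplied by `R` and symmetrized, adds `4πi`. -/
theorem gradient_act (hM : M.IsSymm) (hs : ContDiffOn ℝ ∞ f (space n m)) (hp : p ∈ space n m)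
    (ht : ∀ q ∈ space n m, f (act g q) = autFactor k M g q * f q) :
    dW f (act g p) = autFactor k M g p • (den g p *
      (dW f p - (4 * Real.pi * I * f p) • ((offset g p)ᵀ * toC M))) ∧
    dZ f (act g p) = autFactor k M g p • (den g p *
      (dZ f p + (k * f p) • slope g p +
        (2 * Real.pi * I * f p) • ((offset g p)ᵀ * toC M * offset g p) -
        (1 / 2 : ℂ) • (dW f p * offset g p + (offset g p)ᵀ * (dW f p)ᵀ)) * (den g p)ᵀ) := by
  have hM' : (toC M)ᵀ = toC M := congrArg toC hM
  have h := gradient_solve (d := den g p) (R := offset g p) (GZ := dZ f (act g p))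
    (GW := dW f (act g p))
    (KZ := autFactor k M g p • (dZ f p + (k * f p) • slope g p -
      (2 * Real.pi * I * f p) • ((offset g p)ᵀ * toC M * offset g p)))
    (KW := autFactor k M g p • (dW f p - (4 * Real.pi * I * f p) • ((offset g p)ᵀ * toC M)))
    (isUnit_det_den g hp) (dZ_symm f _)
    (by simp only [Matrix.transpose_smul, Matrix.transpose_add, Matrix.transpose_sub,
          Matrix.transpose_mul, dZ_symm, slope_symm g hp, hM', Matrix.transpose_transpose,
          Matrix.mul_assoc])
    (fun U X hU => by
      have h1 := del_act hs hp ht (pair U X hU)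
      rw [del_eq_trace, del_eq_trace, fderiv_autFactor k hM g hp, Zc_fderiv_act g hp,
        Wc_fderiv_act g hp, Zc_pair, Wc_pair] at h1
      rw [h1]
      simp only [Matrix.smul_mul, Matrix.add_mul, Matrix.sub_mul, Matrix.trace_smul,
        Matrix.trace_add, Matrix.trace_sub, smul_eq_mul]
      ring)
  refine ⟨by rw [h.1, Matrix.mul_smul], ?_⟩
  rw [h.2, ← Matrix.smul_mul (autFactor k M g p), ← Matrix.mul_smul (den g p)]
  congr 2
  simp only [Matrix.smul_mul, Matrix.mul_smul, Matrix.transpose_smul, Matrix.transpose_sub,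
    Matrix.transpose_mul, Matrix.transpose_transpose, hM', Matrix.sub_mul, Matrix.mul_sub,
    Matrix.mul_assoc]
  module

theorem conjM_inv {a : ℕ} {X : Matrix (Fin a) (Fin a) ℂ} (h : IsUnit X.det) :
    conjM X⁻¹ = (conjM X)⁻¹ := by
  refine (Matrix.inv_eq_left_inv ?_).symm
  rw [← conjM_mul, Matrix.nonsing_inv_mul _ h, conjM_one]

/-- The automorphy factor is holomorphic, so its derivative does not enter and only the conjugated
change of coordinates remains. -/
theorem gradientBar_act (hs : ContDiffOn ℝ ∞ f (space n m)) (hp : p ∈ space n m)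
    (ht : ∀ q ∈ space n m, f (act g q) = autFactor k M g q * f q) :
    dWbar f (act g p) = autFactor k M g p • (conjM (den g p) * dWbar f p) ∧
    dZbar f (act g p) = autFactor k M g p • (conjM (den g p) * (dZbar f p -
        (1 / 2 : ℂ) • (dWbar f p * conjM (offset g p) + (conjM (offset g p))ᵀ * (dWbar f p)ᵀ)) *
          (conjM (den g p))ᵀ) := by
  have hd := isUnit_det_den g hp
  have h := gradient_solve (d := conjM (den g p)) (R := conjM (offset g p))
    (GZ := dZbar f (act g p)) (GW := dWbar f (act g p))
    (KZ := autFactor k M g p • dZbar f p) (KW := autFactor k M g p • dWbar f p)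
    (by rw [det_conjM]; exact hd.map _) (dZbar_symm f _)
    (by rw [Matrix.transpose_smul, dZbar_symm])
    (fun U X hU => by
      -- `delBar` is conjugate-linear in the direction; testing on `(Ū, X̄)` makes the traces linear
      -- in `(U, X)`, as `gradient_solve` requires.
      have h1 := delBar_act hs hp ht (pair (conjM U) (conjM X) (by rw [← conjM_transpose, hU]))
      rw [delBar_eq_trace, delBar_eq_trace, Zc_fderiv_act g hp,
        Wc_fderiv_act g hp, Zc_pair, Wc_pair] at h1
      simp only [conjM_mul, conjM_add, conjM_conjM, conjM_transpose, conjM_inv hd] at h1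
      rw [h1, Matrix.smul_mul, Matrix.smul_mul, Matrix.trace_smul, Matrix.trace_smul,
        smul_eq_mul, smul_eq_mul, mul_add])
  refine ⟨by rw [h.1, Matrix.mul_smul], ?_⟩
  rw [h.2, ← Matrix.smul_mul (autFactor k M g p), ← Matrix.mul_smul (conjM (den g p))]
  congr 2
  simp only [Matrix.smul_mul, Matrix.mul_smul, Matrix.transpose_smul]
  module

end FirstOrder

/-! ### Transformation law of the second derivatives -/

section SecondOrder

variable {n m : ℕ}

/-- `h` is real differentiable at `p` with Wirtinger derivative `h'` along `v`. -/
def HasDel (h : Ambient n m → ℂ) (h' : ℂ) (p v : Ambient n m) : Prop :=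
  DifferentiableAt ℝ h p ∧ del h p v = h'

variable {p v : Ambient n m}

theorem HasDel.mul {f h : Ambient n m → ℂ} {f' h' : ℂ} (hf : HasDel f f' p v)
    (hh : HasDel h h' p v) : HasDel (fun q => f q * h q) (f p * h' + h p * f') p v :=
  ⟨hf.1.mul hh.1, by rw [del_mul hf.1 hh.1, hf.2, hh.2]⟩

theorem HasDel.sub {f h : Ambient n m → ℂ} {f' h' : ℂ} (hf : HasDel f f' p v)
    (hh : HasDel h h' p v) : HasDel (fun q => f q - h q) (f' - h') p v := by
  refine ⟨hf.1.sub hh.1, ?_⟩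
  rw [← hf.2, ← hh.2]
  simp only [del, fderiv_fun_sub hf.1 hh.1, sub_apply]
  ring

theorem HasDel.sum {ι : Type*} {s : Finset ι} {F : ι → Ambient n m → ℂ} {F' : ι → ℂ}
    (h : ∀ i ∈ s, HasDel (F i) (F' i) p v) :
    HasDel (fun q => ∑ i ∈ s, F i q) (∑ i ∈ s, F' i) p v :=
  ⟨DifferentiableAt.fun_sum fun i hi => (h i hi).1, by
    rw [del_fun_sum s fun i hi => (h i hi).1]
    exact Finset.sum_congr rfl fun i hi => (h i hi).2⟩

theorem HasDel.of_hasLineDerivAt {h : Ambient n m → ℂ} {h' : ℂ} (hh : DifferentiableAt ℂ h p)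
    (hl : HasLineDerivAt ℂ h h' p v) : HasDel h h' p v :=
  ⟨hh.restrictScalars ℝ, by
    rw [del_of_differentiableAt hh]
    exact (hh.hasFDerivAt.hasLineDerivAt v).unique hl⟩

theorem HasDel.const (c : ℂ) : HasDel (fun _ : Ambient n m => c) 0 p v :=
  HasDel.of_hasLineDerivAt (differentiableAt_const c) (hasDerivAt_const _ _)

theorem HasDel.congr_deriv {h : Ambient n m → ℂ} {h' h'' : ℂ} (hh : HasDel h h' p v)
    (e : h' = h'') : HasDel h h'' p v := e ▸ hh

theorem contDiffAt_del {f : Ambient n m → ℂ} (hs : ContDiffOn ℝ ∞ f (space n m))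
    (hp : p ∈ space n m) (v : Ambient n m) : ContDiffAt ℝ ∞ (fun q => del f q v) p := by
  have h : ContDiffAt ℝ ∞ (fderiv ℝ f) p :=
    (hs.contDiffAt (space_mem_nhds hp)).fderiv_right (m := ∞) (by simp)
  exact contDiffAt_const.mul ((h.clm_apply contDiffAt_const).sub
    (contDiffAt_const.mul (h.clm_apply contDiffAt_const)))

theorem contDiffAt_delBar {f : Ambient n m → ℂ} (hs : ContDiffOn ℝ ∞ f (space n m))
    (hp : p ∈ space n m) (v : Ambient n m) : ContDiffAt ℝ ∞ (fun q => delBar f q v) p := by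
  have h : ContDiffAt ℝ ∞ (fderiv ℝ f) p :=
    (hs.contDiffAt (space_mem_nhds hp)).fderiv_right (m := ∞) (by simp)
  exact contDiffAt_const.mul ((h.clm_apply contDiffAt_const).add
    (contDiffAt_const.mul (h.clm_apply contDiffAt_const)))

variable {f : Ambient n m → ℂ} {k : ℤ} {M : Matrix (Fin m) (Fin m) ℝ} {g : JacobiGroup n m}

theorem transpose_single_mul_mul_apply {N : Matrix (Fin n) (Fin n) ℂ}
    {A : Matrix (Fin m) (Fin m) ℂ} (i j : Fin m) (a b : Fin n) :
    ((Matrix.single i a (1 : ℂ) * N)ᵀ * A) b j = N a b * A i j := by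
  rw [Matrix.mul_apply, Finset.sum_eq_single i]
  · simp
  · intro r _ hr
    simp [Matrix.single_mul_apply_of_ne, hr]
  · simp

/-- The Wirtinger derivative along `∂/∂w_ia` of the entries of the transformed gradient. -/
theorem hasDel_gradient (hM : M.IsSymm) (hs : ContDiffOn ℝ ∞ f (space n m)) (hp : p ∈ space n m)
    (i j : Fin m) (a l : Fin n) :
    HasDel (fun q => autFactor k M g q * ∑ b, den g q l b *
        (dW f q b j - 4 * Real.pi * I * f q * ((offset g q)ᵀ * toC M) b j))
      (autFactor k M g p * ∑ b, den g p l b *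
        (-(4 * Real.pi * I) * ((offset g p)ᵀ * toC M) a i *
            (dW f p b j - 4 * Real.pi * I * f p * ((offset g p)ᵀ * toC M) b j) +
          del (fun q => del f q (dirW j b)) p (dirW i a) -
          4 * Real.pi * I * dW f p a i * ((offset g p)ᵀ * toC M) b j +
          4 * Real.pi * I * f p * (slope g p a b * toC M i j))) p (dirW i a) := by
  have hJ : HasDel (autFactor k M g)
      (autFactor k M g p * (-(4 * Real.pi * I) * ((offset g p)ᵀ * toC M) a i)) p (dirW i a) := by
    have h := differentiableAt_autFactor k M g hp
    refine HasDel.of_hasLineDerivAt h ?_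
    have h' := h.hasFDerivAt.hasLineDerivAt (dirW i a)
    rw [fderiv_autFactor k hM g hp, Zc_dirW, Wc_dirW, Matrix.mul_zero, Matrix.mul_zero,
      Matrix.trace_zero, Matrix.trace_mul_single] at h'
    refine HasDerivAt.congr_deriv (f := fun t : ℂ => autFactor k M g (p + t • dirW i a)) h' ?_
    simp only [MulOpposite.op_one, one_smul]
    ring
  -- `CZ + D` does not involve `W`.
  have hden : ∀ b, HasDel (fun q => den g q l b) 0 p (dirW i a) := fun b => by
    refine HasDel.of_hasLineDerivAt ((smoothAt_den g p l b).differentiableAt (by simp)) ?_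
    have := hasMatDeriv_den (p := p) (v := dirW i a) g l b
    rwa [Zc_dirW, Matrix.mul_zero] at this
  have hoff : ∀ b, HasDel (fun q => ((offset g q)ᵀ * toC M) b j)
      (-(slope g p a b * toC M i j)) p (dirW i a) := fun b => by
    refine HasDel.of_hasLineDerivAt ((((smoothAt_offset g hp).transpose.mul
      (SmoothAt.const (toC M) p)) b j).differentiableAt (by simp)) ?_
    have := ((hasMatDeriv_offset_of_Zc_eq_zero g hp (Zc_dirW i a)).transpose.mul
      (HasMatDeriv.const (toC M))) b j
    rw [Matrix.mul_zero, add_zero, Wc_dirW, Matrix.transpose_neg, Matrix.neg_mul,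
      Matrix.neg_apply, transpose_single_mul_mul_apply] at this
    exact this
  have hf : HasDel f (dW f p a i) p (dirW i a) := ⟨differentiableAt_of_mem hs hp, rfl⟩
  have hW : ∀ b, HasDel (fun q => dW f q b j) (del (fun q => del f q (dirW j b)) p (dirW i a))
      p (dirW i a) := fun b =>
    ⟨(contDiffAt_del hs hp _).differentiableAt (by simp), rfl⟩
  have h := hJ.mul (HasDel.sum (s := Finset.univ) fun b _ =>
    (hden b).mul ((hW b).sub (((HasDel.const (4 * Real.pi * I)).mul hf).mul (hoff b))))
  refine h.congr_deriv ?_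
  simp only [mul_zero, add_zero]
  simp only [Finset.mul_sum, Finset.sum_mul, ← Finset.sum_add_distrib]
  refine Finset.sum_congr rfl fun b _ => ?_
  ring

end SecondOrder

/-! ### Transformation laws of `ddW` and of the matrices inside the determinants. -/

section Laws

variable {n m : ℕ} {f : Ambient n m → ℂ} {k : ℤ} {M : Matrix (Fin m) (Fin m) ℝ}
  {g : JacobiGroup n m} {p : Ambient n m}

/-- The law of `∂f/∂W` holds at every point of the open space, hence can be differentiated again
along `W`. -/
theorem del_gradient_act (hM : M.IsSymm) (hs : ContDiffOn ℝ ∞ f (space n m)) (hp : p ∈ space n m)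
    (ht : ∀ q ∈ space n m, f (act g q) = autFactor k M g q * f q) (i j : Fin m) (c l : Fin n) :
    del (fun q => del f q (dirW j l)) (act g p) (dirW i c) =
      ∑ a, den g p c a * (autFactor k M g p * ∑ b, den g p l b *
        (-(4 * Real.pi * I) * ((offset g p)ᵀ * toC M) a i *
            (dW f p b j - 4 * Real.pi * I * f p * ((offset g p)ᵀ * toC M) b j) +
          del (fun q => del f q (dirW j b)) p (dirW i a) -
          4 * Real.pi * I * dW f p a i * ((offset g p)ᵀ * toC M) b j +
          4 * Real.pi * I * f p * (slope g p a b * toC M i j))) := by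
  have hd := isUnit_det_den g hp
  -- On `W` directions the differential of the action is `X ↦ Xd⁻¹`; the preimage of the unit vector
  -- at `(i, c)` is therefore row `c` of `d` placed in row `i`.
  have hv : fderiv ℂ (act g) p (∑ a, den g p c a • dirW i a) = dirW i c := by
    have hZ : Zc (∑ a, den g p c a • dirW i a : Ambient n m) = 0 := by
      simp only [Zc_sum, Zc_smul, Zc_dirW, smul_zero, Finset.sum_const_zero]
    have hW : Wc (∑ a, den g p c a • dirW i a : Ambient n m) =
        Matrix.single i c (1 : ℂ) * den g p := by
      ext r s
      simp only [Wc_sum, Wc_smul, Wc_dirW, Matrix.sum_apply, Matrix.smul_apply, smul_eq_mul]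
      by_cases hr : r = i
      · subst hr
        simp [Matrix.single_apply]
      · rw [Matrix.single_mul_apply_of_ne _ _ _ _ _ hr]
        simp [Ne.symm hr]
    apply ambient_ext
    · rw [Zc_fderiv_act g hp, hZ, Matrix.mul_zero, Matrix.zero_mul, Zc_dirW]
    · rw [Wc_fderiv_act g hp, hZ, hW, Matrix.mul_zero, add_zero, Wc_dirW, Matrix.mul_assoc,
        Matrix.mul_nonsing_inv _ hd, Matrix.mul_one]
  have hdiff : DifferentiableAt ℝ (fun q => del f q (dirW j l)) (act g p) :=
    (contDiffAt_del hs (act_mem_space g hp) _).differentiableAt (by simp)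
  rw [← hv, ← del_comp (differentiableAt_act g hp) hdiff,
    del_congr (h := fun q => autFactor k M g q * ∑ b, den g q l b *
        (dW f q b j - 4 * Real.pi * I * f q * ((offset g q)ᵀ * toC M) b j))
      (by
        filter_upwards [space_mem_nhds hp] with q hq
        change dW f (act g q) l j = _
        rw [(gradient_act hM hs hq ht).1, Matrix.smul_apply, Matrix.mul_apply, smul_eq_mul]
        rfl)]
  change delLin _ p _ = _
  rw [map_sum]
  refine Finset.sum_congr rfl fun a _ => ?_
  rw [map_smul, smul_eq_mul]
  exact congrArg _ (hasDel_gradient hM hs hp i j a l).2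

/-- Contraction over the indices of `M⁻¹` commutes with the congruence by `d`, whose rows are `x`
and `y`. -/
theorem sum_weighted_congruence (w : Fin m → Fin m → ℂ) (x y : Fin n → ℂ) (J : ℂ)
    (T : Fin m → Fin m → Fin n → Fin n → ℂ) :
    ∑ i, ∑ j, w i j * ∑ a, x a * (J * ∑ b, y b * T i j a b) =
      J * ∑ b, (∑ a, x a * ∑ i, ∑ j, w i j * T i j a b) * y b := by
  have h1 : ∀ i j, w i j * ∑ a, x a * (J * ∑ b, y b * T i j a b) =
      ∑ b, ∑ a, J * (x a * (w i j * T i j a b) * y b) := fun i j => by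
    simp only [Finset.mul_sum]
    rw [Finset.sum_comm]
    exact Finset.sum_congr rfl fun _ _ => Finset.sum_congr rfl fun _ _ => by ring
  simp only [h1]
  have h2 : ∀ F : Fin m → Fin m → Fin n → Fin n → ℂ,
      ∑ i, ∑ j, ∑ b, ∑ a, F i j b a = ∑ b, ∑ a, ∑ i, ∑ j, F i j b a := fun F => by
    have := Finset.sum_comm (s := Finset.univ) (t := Finset.univ)
      (f := fun (r : Fin m × Fin m) (s : Fin n × Fin n) => F r.1 r.2 s.1 s.2)
    simpa only [Fintype.sum_prod_type] using this
  rw [h2]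
  simp only [Finset.mul_sum, Finset.sum_mul]

/-- Contracting with `M⁻¹` turns the products of first-order terms into `RᵗMR` and the symmetrized
`(∂f/∂W)R`; the derivative of `R` itself contributes the `slope` term. -/
theorem ddW_act (hM : M.PosDef) (hs : ContDiffOn ℝ ∞ f (space n m)) (hp : p ∈ space n m)
    (ht : ∀ q ∈ space n m, f (act g q) = autFactor k M g q * f q) :
    ddW M f (act g p) = autFactor k M g p • (den g p *
      (ddW M f p - (4 * Real.pi * I) • (dW f p * offset g p + (offset g p)ᵀ * (dW f p)ᵀ) +
        ((4 * Real.pi * I) ^ 2 * f p) • ((offset g p)ᵀ * toC M * offset g p) +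
        (4 * Real.pi * I * m * f p) • slope g p) * (den g p)ᵀ) := by
  have hsymm : M.IsSymm := by simpa [Matrix.IsHermitian, Matrix.IsSymm] using hM.isHermitian
  have hM' : (toC M)ᵀ = toC M := congrArg toC hsymm
  have hu : IsUnit M.det := (Matrix.isUnit_iff_isUnit_det _).mp hM.isUnit
  have hinv : toC M * toC M⁻¹ = 1 := by rw [← toC_mul, Matrix.mul_nonsing_inv _ hu, toC_one]
  have hinv' : toC M⁻¹ * toC M = 1 := by rw [← toC_mul, Matrix.nonsing_inv_mul _ hu, toC_one]
  have hbil : ∀ (A B : Matrix (Fin n) (Fin m) ℂ) (a b : Fin n),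
      ∑ i, ∑ j, toC M⁻¹ i j * (A a i * B b j) = (A * toC M⁻¹ * Bᵀ) a b := by
    intro A B a b
    simp only [Matrix.mul_apply, Matrix.transpose_apply, Finset.sum_mul]
    rw [Finset.sum_comm]
    exact Finset.sum_congr rfl fun _ _ => Finset.sum_congr rfl fun _ _ => by ring
  -- `Tr(M⁻¹M) = m` is the origin of the term in `m` of the heat operator.
  have htr : ∑ i, ∑ j, toC M⁻¹ i j * toC M i j = m := by
    have h : (toC M⁻¹ * (toC M)ᵀ).trace = m := by rw [hM', hinv', Matrix.trace_one]; simp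
    rw [← h]
    simp [Matrix.trace, Matrix.mul_apply]
  have hQ : ∀ a b, ∑ i, ∑ j, toC M⁻¹ i j *
      (-(4 * Real.pi * I) * ((offset g p)ᵀ * toC M) a i *
            (dW f p b j - 4 * Real.pi * I * f p * ((offset g p)ᵀ * toC M) b j) +
          del (fun q => del f q (dirW j b)) p (dirW i a) -
          4 * Real.pi * I * dW f p a i * ((offset g p)ᵀ * toC M) b j +
          4 * Real.pi * I * f p * (slope g p a b * toC M i j)) =
      (ddW M f p - (4 * Real.pi * I) • (dW f p * offset g p + (offset g p)ᵀ * (dW f p)ᵀ) +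
        ((4 * Real.pi * I) ^ 2 * f p) • ((offset g p)ᵀ * toC M * offset g p) +
        (4 * Real.pi * I * m * f p) • slope g p : Matrix (Fin n) (Fin n) ℂ) a b := by
    intro a b
    have h1 := hbil ((offset g p)ᵀ * toC M) (dW f p) a b
    have h2 := hbil ((offset g p)ᵀ * toC M) ((offset g p)ᵀ * toC M) a b
    have h3 := hbil (dW f p) ((offset g p)ᵀ * toC M) a b
    rw [Matrix.mul_assoc _ (toC M), hinv, Matrix.mul_one] at h1 h2
    rw [Matrix.transpose_mul, Matrix.transpose_transpose, hM'] at h2 h3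
    rw [← Matrix.mul_assoc] at h2
    rw [Matrix.mul_assoc, ← Matrix.mul_assoc (toC M⁻¹), hinv', Matrix.one_mul] at h3
    have h4 : ddW M f p a b =
      ∑ i, ∑ j, toC M⁻¹ i j * del (fun q => del f q (dirW j b)) p (dirW i a) := rfl
    simp only [Matrix.add_apply, Matrix.sub_apply, Matrix.smul_apply, smul_eq_mul]
    rw [← h1, ← h2, ← h3, h4, ← htr]
    simp only [Finset.mul_sum, Finset.sum_mul, ← Finset.sum_add_distrib,
      ← Finset.sum_sub_distrib]
    exact Finset.sum_congr rfl fun _ _ => Finset.sum_congr rfl fun _ _ => by ring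
  ext c l
  rw [Matrix.smul_apply, Matrix.mul_apply, smul_eq_mul]
  simp only [Matrix.mul_apply (M := den g p), ← hQ, Matrix.transpose_apply]
  have hdd : ddW M f (act g p) c l = ∑ i, ∑ j,
      toC M⁻¹ i j * del (fun q => del f q (dirW j l)) (act g p) (dirW i c) := rfl
  refine hdd.trans (Eq.trans ?_ (sum_weighted_congruence (fun i j => toC M⁻¹ i j) (fun a => den g p c a)
    (fun b => den g p l b) (autFactor k M g p) _))
  exact Finset.sum_congr rfl fun i _ => Finset.sum_congr rfl fun j _ =>
    congrArg _ (del_gradient_act hsymm hs hp ht i j c l)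

/-- Transformation law of the matrix in the first raising operator. -/
theorem raise1_matrix_act (hM : M.IsSymm) (hs : ContDiffOn ℝ ∞ f (space n m)) (hp : p ∈ space n m)
    (ht : ∀ q ∈ space n m, f (act g q) = autFactor k M g q * f q) :
    dW f (act g p) + (4 * Real.pi * I * f (act g p)) •
        ((Y (act g p))⁻¹ * (V (act g p))ᵀ * toC M) =
      autFactor k M g p • (den g p *
        (dW f p + (4 * Real.pi * I * f p) • ((Y p)⁻¹ * (V p)ᵀ * toC M))) := by
  have hP : ∀ q : Ambient n m, (Y q)⁻¹ * (V q)ᵀ = (V q * (Y q)⁻¹)ᵀ := fun q => by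
    rw [Matrix.transpose_mul, Matrix.transpose_nonsing_inv, Y_symm]
  rw [hP, hP, V_act_mul_Y_act_inv g hp, (gradient_act hM hs hp ht).1, ht p hp]
  simp only [Matrix.transpose_mul, Matrix.transpose_add, Matrix.transpose_transpose,
    Matrix.add_mul, Matrix.mul_add, Matrix.mul_sub, Matrix.mul_smul, Matrix.mul_assoc]
  module

/-- Transformation law of the matrix in the second raising operator. -/
theorem raise2_matrix_act (hM : M.IsSymm) (hs : ContDiffOn ℝ ∞ f (space n m)) (hp : p ∈ space n m)
    (ht : ∀ q ∈ space n m, f (act g q) = autFactor k M g q * f q) :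
    dZ f (act g p) - (I * k / 2 * f (act g p)) • (Y (act g p))⁻¹ +
      (2 * Real.pi * I * f (act g p)) • ((Y (act g p))⁻¹ * (V (act g p))ᵀ * toC M *
        V (act g p) * (Y (act g p))⁻¹) +
      (1 / 2 : ℂ) • (dW f (act g p) * V (act g p) * (Y (act g p))⁻¹) +
      (1 / 2 : ℂ) • ((Y (act g p))⁻¹ * (V (act g p))ᵀ * (dW f (act g p))ᵀ) =
      autFactor k M g p • (den g p *
        (dZ f p - (I * k / 2 * f p) • (Y p)⁻¹ +
      (2 * Real.pi * I * f p) • ((Y p)⁻¹ * (V p)ᵀ * toC M * V p * (Y p)⁻¹) +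
      (1 / 2 : ℂ) • (dW f p * V p * (Y p)⁻¹) + (1 / 2 : ℂ) • ((Y p)⁻¹ * (V p)ᵀ * (dW f p)ᵀ)) *
        (den g p)ᵀ) := by
  have hM' : (toC M)ᵀ = toC M := congrArg toC hM
  have hP : ∀ q : Ambient n m, (Y q)⁻¹ * (V q)ᵀ = (V q * (Y q)⁻¹)ᵀ := fun q => by
    rw [Matrix.transpose_mul, Matrix.transpose_nonsing_inv, Y_symm]
  simp only [hP, Matrix.mul_assoc _ (V _) (Y _)⁻¹]
  rw [V_act_mul_Y_act_inv g hp, (gradient_act hM hs hp ht).1, (gradient_act hM hs hp ht).2, ht p hp,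
    Y_act_inv g hp]
  generalize V p * (Y p)⁻¹ = P
  generalize (Y p)⁻¹ = Y'
  simp only [Matrix.transpose_mul, Matrix.transpose_add, Matrix.transpose_sub,
    Matrix.transpose_smul, Matrix.transpose_transpose, hM',
    Matrix.add_mul, Matrix.sub_mul, Matrix.mul_add, Matrix.mul_sub, Matrix.mul_smul,
    Matrix.smul_mul, Matrix.mul_assoc, smul_add, smul_sub, smul_smul]
  -- The terms `RᵗMR` cancel as `2πi + 2πi - 4πi`. The `slope` term needs `I² = -1`: its coefficient
  -- `k` from `∂f/∂Z` meets `(-ik/2)(-2i) = -k` from `Y⁻¹`.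
  match_scalars <;> first
    | ring1
    | linear_combination (k * autFactor k M g p * f p) * Complex.I_sq

/-- Transformation law of the matrix in the heat operator. -/
theorem heat_matrix_act (hM : M.PosDef) (hs : ContDiffOn ℝ ∞ f (space n m)) (hp : p ∈ space n m)
    (ht : ∀ q ∈ space n m, f (act g q) = autFactor k M g q * f q) :
    -(8 * Real.pi * I) • dZ f (act g p) + ddW M f (act g p) -
        (4 * Real.pi * k * f (act g p)) • (Y (act g p))⁻¹ +
        (2 * m * Real.pi * f (act g p)) • (Y (act g p))⁻¹ =
      autFactor k M g p • (den g p *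
        (-(8 * Real.pi * I) • dZ f p + ddW M f p - (4 * Real.pi * k * f p) • (Y p)⁻¹ +
          (2 * m * Real.pi * f p) • (Y p)⁻¹) * (den g p)ᵀ) := by
  have hsymm : M.IsSymm := by simpa [Matrix.IsHermitian, Matrix.IsSymm] using hM.isHermitian
  rw [(gradient_act hsymm hs hp ht).2, ddW_act hM hs hp ht, ht p hp, Y_act_inv g hp]
  generalize (Y p)⁻¹ = Y'
  simp only [Matrix.add_mul, Matrix.sub_mul, Matrix.mul_add, Matrix.mul_sub, Matrix.mul_smul,
    Matrix.smul_mul, Matrix.mul_assoc, smul_add, smul_sub, smul_smul]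
  -- Cancellations: `-8πi · 2πi + (4πi)² = 0` for `RᵗMR`, `4πi - 4πi = 0` for the mixed terms, and
  -- `-8πik + 4πim - 2i(-4πk + 2πm) = 0` for `slope`, which fixes the coefficients of `Y⁻¹`.
  match_scalars <;> ring

theorem conjM_V_mul_Y_inv (hp : p ∈ space n m) : conjM (V p * (Y p)⁻¹) = V p * (Y p)⁻¹ := by
  rw [conjM_mul, conjM_V, conjM_inv (isUnit_det_Y hp), conjM_Y]

theorem Y_act (g : JacobiGroup n m) (hp : p ∈ space n m) :
    Y (act g p) = ((conjM (den g p))ᵀ)⁻¹ * Y p * (den g p)⁻¹ := by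
  have hd := isUnit_det_den g hp
  have hc : IsUnit ((conjM (den g p))ᵀ).det := by
    rw [Matrix.det_transpose, det_conjM]; exact hd.map _
  rw [← Y_act_conj g hp, Matrix.mul_assoc, Matrix.mul_assoc, Matrix.mul_assoc,
    Matrix.mul_nonsing_inv _ hd, Matrix.mul_one, ← Matrix.mul_assoc, Matrix.nonsing_inv_mul _ hc,
    Matrix.one_mul]

/-- Transformation law of the matrix in the second lowering operator. -/
theorem lower2_matrix_act (hs : ContDiffOn ℝ ∞ f (space n m)) (hp : p ∈ space n m)
    (ht : ∀ q ∈ space n m, f (act g q) = autFactor k M g q * f q) :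
    Y (act g p) * dZbar f (act g p) * Y (act g p) +
        (1 / 2 : ℂ) • (Y (act g p) * dWbar f (act g p) * V (act g p)) +
        (1 / 2 : ℂ) • ((V (act g p))ᵀ * (dWbar f (act g p))ᵀ * Y (act g p)) =
      autFactor k M g p • (((den g p)⁻¹)ᵀ * (Y p * dZbar f p * Y p +
        (1 / 2 : ℂ) • (Y p * dWbar f p * V p) +
        (1 / 2 : ℂ) • ((V p)ᵀ * (dWbar f p)ᵀ * Y p)) * (den g p)⁻¹) := by
  have hd := isUnit_det_den g hp
  have hc : IsUnit (conjM (den g p)).det := by rw [det_conjM]; exact hd.map _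
  have hct : IsUnit ((conjM (den g p))ᵀ).det := by rwa [Matrix.det_transpose]
  have hq := act_mem_space g hp
  -- With `Y` factored out on both sides, the inner matrix involves `V` only through `VY⁻¹` and
  -- transforms by `d̄` and `d̄ᵗ`.
  have key : ∀ q ∈ space n m, Y q * dZbar f q * Y q + (1 / 2 : ℂ) • (Y q * dWbar f q * V q) +
      (1 / 2 : ℂ) • ((V q)ᵀ * (dWbar f q)ᵀ * Y q) =
      Y q * (dZbar f q + (1 / 2 : ℂ) • (dWbar f q * (V q * (Y q)⁻¹) +
        (V q * (Y q)⁻¹)ᵀ * (dWbar f q)ᵀ)) * Y q := fun q hq => by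
    have hY := isUnit_det_Y hq
    rw [Matrix.transpose_mul, Matrix.transpose_nonsing_inv, Y_symm]
    simp only [Matrix.mul_add, Matrix.add_mul, Matrix.mul_smul, Matrix.smul_mul, smul_add,
      Matrix.mul_assoc]
    rw [Matrix.nonsing_inv_mul _ hY, Matrix.mul_one, ← Matrix.mul_assoc (Y q) (Y q)⁻¹,
      Matrix.mul_nonsing_inv _ hY, Matrix.one_mul, add_assoc]
  -- `VY⁻¹` is real, so its law may be conjugated; this produces the `R̄` of `gradientBar_act`.
  have hP : V (act g p) * (Y (act g p))⁻¹ =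
      (V p * (Y p)⁻¹ + conjM (offset g p)) * (conjM (den g p))ᵀ := by
    rw [← conjM_V_mul_Y_inv hq, V_act_mul_Y_act_inv g hp, conjM_mul, conjM_add,
      conjM_V_mul_Y_inv hp, conjM_transpose]
  have hYl : Y (act g p) = ((den g p)⁻¹)ᵀ * Y p * (conjM (den g p))⁻¹ := by
    have h := congrArg Matrix.transpose (Y_act g hp)
    rw [Y_symm, Matrix.transpose_mul, Matrix.transpose_mul, Y_symm, Matrix.transpose_nonsing_inv
      (conjM (den g p))ᵀ, Matrix.transpose_transpose, ← Matrix.mul_assoc] at h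
    exact h
  rw [key _ hq, key _ hp, hP, (gradientBar_act hs hp ht).1, (gradientBar_act hs hp ht).2]
  have hin : autFactor k M g p • (conjM (den g p) * (dZbar f p -
        (1 / 2 : ℂ) • (dWbar f p * conjM (offset g p) + (conjM (offset g p))ᵀ * (dWbar f p)ᵀ)) *
          (conjM (den g p))ᵀ) + (1 / 2 : ℂ) • (autFactor k M g p • (conjM (den g p) * dWbar f p) *
          ((V p * (Y p)⁻¹ + conjM (offset g p)) * (conjM (den g p))ᵀ) +
          ((V p * (Y p)⁻¹ + conjM (offset g p)) * (conjM (den g p))ᵀ)ᵀ *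
            (autFactor k M g p • (conjM (den g p) * dWbar f p))ᵀ) =
      autFactor k M g p • (conjM (den g p) * (dZbar f p + (1 / 2 : ℂ) •
        (dWbar f p * (V p * (Y p)⁻¹) + (V p * (Y p)⁻¹)ᵀ * (dWbar f p)ᵀ)) *
          (conjM (den g p))ᵀ) := by
    generalize V p * (Y p)⁻¹ = P
    simp only [Matrix.transpose_mul, Matrix.transpose_add, Matrix.transpose_smul,
      Matrix.transpose_transpose, Matrix.add_mul, Matrix.sub_mul, Matrix.mul_add, Matrix.mul_sub,
      Matrix.mul_smul, Matrix.smul_mul, Matrix.mul_assoc, smul_add, smul_sub, smul_smul]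
    module
  rw [hin]
  generalize dZbar f p + (1 / 2 : ℂ) •
        (dWbar f p * (V p * (Y p)⁻¹) + (V p * (Y p)⁻¹)ᵀ * (dWbar f p)ᵀ) = B
  -- The left `Y` is written with `d̄⁻¹` on its right and the other one with `d̄⁻ᵗ` on its left, so
  -- that both cancel against the inner matrix.
  nth_rewrite 1 [hYl]
  rw [Y_act g hp]
  simp only [Matrix.mul_smul, Matrix.smul_mul, Matrix.mul_assoc]
  rw [← Matrix.mul_assoc (conjM (den g p))ᵀ, Matrix.mul_nonsing_inv _ hct, Matrix.one_mul,
    ← Matrix.mul_assoc (conjM (den g p))⁻¹, Matrix.nonsing_inv_mul _ hc, Matrix.one_mul]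

end Laws

/-! ### The operators on Jacobi forms -/

section Main

variable {n m : ℕ} {f : Ambient n m → ℂ} {k : ℤ} {M : Matrix (Fin m) (Fin m) ℝ}
  {g : JacobiGroup n m} {p : Ambient n m}

/-- The exponent is linear in the index, so the `n`-th power multiplies weight and index by `n`;
`det(d)ᵉ` only shifts the weight. -/
theorem autFactor_pow (k e : ℤ) (M : Matrix (Fin m) (Fin m) ℝ) (g : JacobiGroup n m)
    (hp : p ∈ space n m) :
    autFactor (n * k + e) ((n : ℝ) • M) g p = autFactor k M g p ^ n * (den g p).det ^ e := by
  have hd := (isUnit_det_den g hp).ne_zero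
  have hsm : toC ((n : ℝ) • M) = (n : ℂ) • toC M := by
    ext i j
    simp [toC]
  have hE : expo ((n : ℝ) • M) g p = n * expo M g p := by
    rw [expo, expo, hsm, Matrix.smul_mul, Matrix.smul_mul, ← smul_sub, Matrix.trace_smul,
      smul_eq_mul]
    ring
  rw [autFactor_eq, autFactor_eq, hE, Complex.exp_nat_mul, mul_pow, zpow_add₀ hd, mul_comm (n : ℤ),
    zpow_mul, zpow_natCast]
  ring

/-- The common reduction: what remains for each operator is smoothness and the exponent `e`.
Positivity of `n` keeps the index `nM` positive definite. -/
theorem IsJacobiForm.of_det_law {Γ : Subgroup (JacobiGroup n m)} (hn : 0 < n)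
    (hf : IsJacobiForm Γ k M f) {e : ℤ} {F : Ambient n m → ℂ}
    (hF : ∀ p ∈ space n m, ContDiffAt ℝ ∞ F p)
    (h : ∀ g ∈ Γ, ∀ p ∈ space n m,
      F (act g p) = autFactor k M g p ^ n * (den g p).det ^ e * F p) :
    IsJacobiForm Γ (n * k + e) ((n : ℝ) • M) F where
  index_posDef := hf.index_posDef.smul (by exact_mod_cast hn)
  index_halfIntegral := by
    refine ⟨fun i => ?_, fun i j => ?_⟩
    · obtain ⟨a, ha⟩ := hf.index_halfIntegral.1 i
      exact ⟨n * a, by simp [ha]⟩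
    · obtain ⟨a, ha⟩ := hf.index_halfIntegral.2 i j
      refine ⟨n * a, ?_⟩
      push_cast
      rw [← ha, Matrix.smul_apply, smul_eq_mul]
      ring
  smooth p hp := (hF p hp).contDiffWithinAt
  transform g hg p hp := by rw [h g hg p hp, autFactor_pow k e M g hp]

theorem smoothAt_toC_im {a b : ℕ} {F : Ambient n m → Matrix (Fin a) (Fin b) ℂ}
    (hF : SmoothAt ℂ F p) : SmoothAt ℝ (fun q => toC ((F q).map Complex.im)) p := fun i j =>
  (Complex.ofRealCLM.comp Complex.imCLM).contDiff.contDiffAt.comp p ((hF i j).restrict_scalars ℝ)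

theorem smoothAt_Y (p : Ambient n m) : SmoothAt ℝ Y p := smoothAt_toC_im (smoothAt_Zc p)

theorem smoothAt_V (p : Ambient n m) : SmoothAt ℝ V p := smoothAt_toC_im (smoothAt_Wc p)

theorem smoothAt_Y_inv (hp : p ∈ space n m) :
    SmoothAt ℝ (fun q : Ambient n m => (Y q)⁻¹) p :=
  (smoothAt_Y p).inv (isUnit_det_Y hp)

theorem smoothAt_dW (hs : ContDiffOn ℝ ∞ f (space n m)) (hp : p ∈ space n m) :
    SmoothAt ℝ (dW f) p := fun j i => contDiffAt_del hs hp (dirW i j)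

theorem smoothAt_dZ (hs : ContDiffOn ℝ ∞ f (space n m)) (hp : p ∈ space n m) :
    SmoothAt ℝ (dZ f) p := fun i j => contDiffAt_del hs hp (dirZ i j)

theorem smoothAt_dWbar (hs : ContDiffOn ℝ ∞ f (space n m)) (hp : p ∈ space n m) :
    SmoothAt ℝ (dWbar f) p := fun j i => contDiffAt_delBar hs hp (dirW i j)

theorem smoothAt_dZbar (hs : ContDiffOn ℝ ∞ f (space n m)) (hp : p ∈ space n m) :
    SmoothAt ℝ (dZbar f) p := fun i j => contDiffAt_delBar hs hp (dirZ i j)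

theorem smoothAt_ddW (M : Matrix (Fin m) (Fin m) ℝ) (hs : ContDiffOn ℝ ∞ f (space n m))
    (hp : p ∈ space n m) : SmoothAt ℝ (ddW M f) p := by
  intro a l
  have h : ∀ i j, ContDiffAt ℝ ∞ (fun q => del (fun q => del f q (dirW j l)) q (dirW i a)) p :=
    fun i j => contDiffAt_del (fun _ hq => (contDiffAt_del hs hq _).contDiffWithinAt) hp _
  change ContDiffAt ℝ ∞ (fun q => ∑ i, ∑ j, ((M⁻¹ i j : ℝ) : ℂ) *
    del (fun q => del f q (dirW j l)) q (dirW i a)) p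
  exact ContDiffAt.sum fun i _ => ContDiffAt.sum fun j _ => contDiffAt_const.mul (h i j)

/-- Selecting columns commutes with multiplication on the left, so any choice of rows of `W` is
compatible with the action. -/
theorem submatrix_smul_mul (c : ℂ) (A : Matrix (Fin n) (Fin n) ℂ) (B : Matrix (Fin n) (Fin m) ℂ)
    (σ : Fin n ↪ Fin m) :
    (c • (A * B)).submatrix id σ = c • (A * B.submatrix id σ) := rfl

variable {Γ : Subgroup (JacobiGroup n m)}

theorem isJacobiForm_raise1 (hn : 0 < n) (hf : IsJacobiForm Γ k M f) (σ : Fin n ↪ Fin m) :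
    IsJacobiForm Γ (n * k + 1) ((n : ℝ) • M) (raise1 M σ f) := by
  have hM : M.IsSymm := by
    simpa [Matrix.IsHermitian, Matrix.IsSymm] using hf.index_posDef.isHermitian
  refine hf.of_det_law hn (fun p hp => SmoothAt.det fun i j => ?_) fun g hg p hp => ?_
  · exact ((smoothAt_dW hf.smooth hp).add (SmoothAt.smul
      (contDiffAt_const.mul (hf.smooth.contDiffAt (space_mem_nhds hp)))
      (((smoothAt_Y_inv hp).mul (smoothAt_V p).transpose).mul (SmoothAt.const _ p)))) i (σ j)
  · rw [raise1, raise1_matrix_act hM hf.smooth hp (hf.transform g hg), submatrix_smul_mul,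
      Matrix.det_smul, Matrix.det_mul, Fintype.card_fin, zpow_one, raise1, ← mul_assoc (autFactor k M g p ^ n)]

/-- The `det d̄` from the gradient cancels the `det d̄⁻ᵗ` from `Y`, leaving `det(d)⁻¹`. -/
theorem isJacobiForm_lower1 (hn : 0 < n) (hf : IsJacobiForm Γ k M f) (σ : Fin n ↪ Fin m) :
    IsJacobiForm Γ (n * k - 1) ((n : ℝ) • M) (lower1 σ f) := by
  rw [sub_eq_add_neg]
  refine hf.of_det_law hn (fun p hp => SmoothAt.det ?_) fun g hg p hp => ?_
  · exact SmoothAt.mul (fun i j => smoothAt_dWbar hf.smooth hp i (σ j)) (smoothAt_Y p)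
  · have hd := (isUnit_det_den g hp).ne_zero
    have hc : (conjM (den g p)).det ≠ 0 := by
      rw [det_conjM]; exact ((isUnit_det_den g hp).map _).ne_zero
    rw [lower1, (gradientBar_act hf.smooth hp (hf.transform g hg)).1, submatrix_smul_mul,
      Y_act g hp, Matrix.smul_mul, Matrix.det_smul]
    simp only [Matrix.det_mul, Fintype.card_fin, lower1, Matrix.det_nonsing_inv,
      Matrix.det_transpose, Ring.inverse_eq_inv', zpow_neg, zpow_one]
    field_simp

theorem isJacobiForm_heat (hn : 0 < n) (hf : IsJacobiForm Γ k M f) :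
    IsJacobiForm Γ (n * k + 2) ((n : ℝ) • M) (heat k M f) := by
  refine hf.of_det_law hn (fun p hp => SmoothAt.det ?_) fun g hg p hp => ?_
  · have hfp := hf.smooth.contDiffAt (space_mem_nhds hp)
    exact (((SmoothAt.smul contDiffAt_const (smoothAt_dZ hf.smooth hp)).add
      (smoothAt_ddW M hf.smooth hp)).sub
        (SmoothAt.smul (contDiffAt_const.mul hfp) (smoothAt_Y_inv hp))).add
          (SmoothAt.smul (contDiffAt_const.mul hfp) (smoothAt_Y_inv hp))
  · rw [heat, heat_matrix_act hf.index_posDef hf.smooth hp (hf.transform g hg), Matrix.det_smul,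
      Matrix.det_mul, Matrix.det_mul, Matrix.det_transpose, Fintype.card_fin, heat, zpow_ofNat]
    ring

theorem isJacobiForm_raise2 (hn : 0 < n) (hf : IsJacobiForm Γ k M f) :
    IsJacobiForm Γ (n * k + 2) ((n : ℝ) • M) (raise2 k M f) := by
  have hM : M.IsSymm := by
    simpa [Matrix.IsHermitian, Matrix.IsSymm] using hf.index_posDef.isHermitian
  refine hf.of_det_law hn (fun p hp => SmoothAt.det ?_) fun g hg p hp => ?_
  · have hfp := hf.smooth.contDiffAt (space_mem_nhds hp)
    have hY := smoothAt_Y_inv hp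
    have hV := smoothAt_V p
    have hW := smoothAt_dW hf.smooth hp
    exact ((((smoothAt_dZ hf.smooth hp).sub
      (SmoothAt.smul (contDiffAt_const.mul hfp) hY)).add
        (SmoothAt.smul (contDiffAt_const.mul hfp)
          ((((hY.mul hV.transpose).mul (SmoothAt.const _ p)).mul hV).mul hY))).add
            (SmoothAt.smul contDiffAt_const ((hW.mul hV).mul hY))).add
              (SmoothAt.smul contDiffAt_const ((hY.mul hV.transpose).mul hW.transpose))
  · rw [raise2, raise2_matrix_act hM hf.smooth hp (hf.transform g hg), Matrix.det_smul,
      Matrix.det_mul, Matrix.det_mul, Matrix.det_transpose, Fintype.card_fin, raise2, zpow_ofNat]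
    ring

theorem isJacobiForm_lower2 (hn : 0 < n) (hf : IsJacobiForm Γ k M f) :
    IsJacobiForm Γ (n * k - 2) ((n : ℝ) • M) (lower2 f) := by
  rw [sub_eq_add_neg]
  refine hf.of_det_law hn (fun p hp => SmoothAt.det ?_) fun g hg p hp => ?_
  · have hY := smoothAt_Y p
    have hV := smoothAt_V p
    have hW := smoothAt_dWbar hf.smooth hp
    exact (((hY.mul (smoothAt_dZbar hf.smooth hp)).mul hY).add
      (SmoothAt.smul contDiffAt_const ((hY.mul hW).mul hV))).add
        (SmoothAt.smul contDiffAt_const ((hV.transpose.mul hW.transpose).mul hY))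
  · have hd := (isUnit_det_den g hp).ne_zero
    rw [lower2, lower2_matrix_act hf.smooth hp (hf.transform g hg), Matrix.det_smul,
      Matrix.det_mul, Matrix.det_mul, Matrix.det_transpose, Fintype.card_fin, lower2,
      Matrix.det_nonsing_inv, Ring.inverse_eq_inv', zpow_neg, zpow_ofNat]
    field_simp

end Main

end SiegelJacobi

end

open SiegelJacobi in
theorem theorem1p1 (n m : ℕ) (hn : 0 < n) (hm : 0 < m) (Γ : Subgroup (JacobiGroup n m))
    (k : ℤ) (M : Matrix (Fin m) (Fin m) ℝ) (f : Ambient n m → ℂ) (hf : IsJacobiForm Γ k M f) :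
    (∀ σ : Fin n ↪ Fin m,
      IsJacobiForm Γ (n * k + 1) ((n : ℝ) • M) (raise1 M σ f) ∧
      IsJacobiForm Γ (n * k - 1) ((n : ℝ) • M) (lower1 σ f)) ∧
    IsJacobiForm Γ (n * k + 2) ((n : ℝ) • M) (heat k M f) ∧
    IsJacobiForm Γ (n * k + 2) ((n : ℝ) • M) (raise2 k M f) ∧
    IsJacobiForm Γ (n * k - 2) ((n : ℝ) • M) (lower2 f) :=
  ⟨fun σ => ⟨isJacobiForm_raise1 hn hf σ, isJacobiForm_lower1 hn hf σ⟩,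
    isJacobiForm_heat hn hf, isJacobiForm_raise2 hn hf, isJacobiForm_lower2 hn hf⟩
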